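/- **Definitions.** A *tree* is a finite non-empty poset with binary suprema in which no subset that is not linearly ordered has an infimum. A *thicket* is a finite poset $T$ such that $\{t'\in T: t'\le t\}$ is a tree for every $t\in T$. $\mathrm{St}(T)$ is the set, ordered by inclusion, of order-convex subsets of $T$ with a largest element. A *thicket complex* $(T,\tau)$ is a sequence of thickets $T_i$ ($i\in\mathbb N$), almost all empty, with $T_0$ a singleton, together with monotone maps $\tau_i:T_{i+1}\to \mathrm{St}(T_i)$ such that $\tau_i(t)\cap\tau_i(t')\ne\emptyset$ implies $t\le t'$ or $t'\le t$. The poset $T_{i+1}\lhd T_i$ is the disjoint union of $\{t^\circ:t\in T_{i+1}\}$, ordered as $T_{i+1}$, and of $\{s^\bullet:s\in T_i\}$, which is discretely ordered, with $s^\bullet<t^\circ$ iff $s\in\tau_i(t)$. A *morphism* $f:(S,\sigma)\to(T,\tau)$ is a family of order embeddings $f_i:S_i\to T_i$ such that each induced map $\vec f_i=f_{i+1}\lhd f_i:S_{i+1}\lhd S_i\to T_{i+1}\lhd T_i$ is an order embedding that preserves binary suprema as a partial operation: $x\vee y$ exists iff $\vec f_i(x)\vee\vec f_i(y)$ exists,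 and then $\vec f_i(x\vee y)=\vec f_i(x)\vee\vec f_i(y)$. These form the category $\mathbf{cThicket}$. A *positive hypergraph* $P$ consists of finite sets $P_k$ ($k\in\mathbb N$), only finitely many non-empty, functions $\gamma:P_{k+1}\to P_k$, and non-empty sets $\delta(a)\subseteq P_k$ for $a\in P_{k+1}$, where $\delta(a)$ is a singleton for $a\in P_1$. On $P_k$ let $<^+$ be the transitive closure of $\{(a,b):\exists\alpha\in P_{k+1},\ a\in\delta(\alpha),\ \gamma(\alpha)=b\}$, and (for $k>0$) let $<^-$ be the transitive closure of $\{(a,b):\gamma(a)\in\delta(b)\}$; $<^-$ is empty on $P_0$. $P$ is a *positive opetopic cardinal* if $P_0\neq\emptyset$; $\{\gamma\gamma(a)\}=\gamma\delta(a)\setminus\delta\delta(a)$ and $\delta\gamma(a)=\delta\delta(a)\setminus\gamma\delta(a)$ for all $a$ of dimension $\ge2$; $<^+$ is a strict order on each $P_k$, linear on $P_0$; no two faces are comparable both by $<^-$ and by $<^+$; and for $k>0$, $x\in P_{k-1}$ the sets $\{a\in P_k:\gamma(a)=x\}$ and $\{a\in P_k:x\in\delta(a)\}$ are linearly ordered by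 $<^+$. Let $\gamma^{(k)}(p)$ be the face obtained from $p$ by applying $\gamma$ until the dimension is at most $k$. A *$\iota$-epimorphism* $h:P\to Q$ is a surjection from the set of faces of $P$ to that of $Q$ such that, with $\ker h=\{p:\dim h(p)<\dim p\}$: $\dim h(p)\le\dim p$ for all $p$; and, for all $k$ and $p\in P_{k+1}$, $h(\gamma(p))=\gamma^{(k)}(h(p))$, and $h$ restricts to a bijection $\delta(p)\setminus\ker h\to\delta(h(p))$ if $\dim h(p)=k+1$, to a bijection $\delta(p)\setminus\ker h\to\{h(p)\}$ if $\dim h(p)=k$, while $\delta(p)\subseteq\ker h$ if $\dim h(p)<k$. These form the category $\mathbf{pOpeCard}_{\iota,epi}$. **The functors.** For a positive opetopic cardinal $P$ let $P^*_i=P_i\setminus\gamma(P_{i+1})$, ordered by $\le^-$, and $\pi_i(p)=\{s\in P^*_i:s<^+\gamma(p)\}$ for $p\in P^*_{i+1}$. For a $\iota$-epimorphism $f:P\to Q$ and $q\in Q_i^*$ let $f^*_i(q)$ be the unique $p\in P^*_i$ with $f(p)=q$. For a thicket complex $(T,\tau)$ let $T^*_i=T_{i+1}\lhd T_i$ and,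 for $p\in T^*_{i+1}$, let $L(p)=\{s^\circ: s\in T_{i+1},\ s^\bullet\le p\}\subseteq T^*_i$, $\gamma(p)=\sup L(p)$, and let $\delta(p)$ be the set of elements of $T^*_i\setminus L(p)$ covered by an element of $L(p)$. For a morphism $f:S\to T$ and $t\in T^*_i$ let $f^*(t)=s\in S^*_j$, where $j\le i$ is the largest number for which there is $s'\in S_j^*$ such that $\vec f_j(s')$ is below some element of $\delta\gamma^{(j+1)}(t)$ (read as $\{t\}$ if $j=i$), and $s$ is the largest such $s'$. **Theorem.** These assignments are well-defined functors $(-)^*:\mathbf{pOpeCard}_{\iota,epi}\to\mathbf{cThicket}^{op}$ and $(-)^*:\mathbf{cThicket}^{op}\to\mathbf{pOpeCard}_{\iota,epi}$, and they form an equivalence of categories. Thus the category of positive opetopic cardinals with $\iota$-epimorphisms is dually equivalent to the category of thicket complexes with embeddings preserving binary suprema. -/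

import Mathlib

open CategoryTheory

universe u

namespace OpeDuality

/-! ### Trees, thickets and convex subtrees -/

/-- A (non-empty) tree: a finite poset with binary suprema in which no subset that is not linearly
ordered has an infimum. -/
def IsTree (α : Type u) [PartialOrder α] : Prop :=
  Finite α ∧ Nonempty α ∧ (∀ x y : α, ∃ z, IsLUB {x, y} z) ∧
    ∀ X : Set α, (∃ z, IsGLB X z) → IsChain (· ≤ ·) X

/-- A thicket: a finite poset all of whose principal down-sets are trees. -/
def IsThicket (α : Type u) [PartialOrder α] : Prop :=
  Finite α ∧ ∀ p : α, IsTree (Set.Iic p)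

/-- Convex subtrees: order-convex subsets with a largest element. They are ordered by inclusion. -/
def IsConvexSubtree {α : Type u} [PartialOrder α] (X : Set α) : Prop :=
  (∃ m, IsGreatest X m) ∧ ∀ x ∈ X, ∀ x' ∈ X, ∀ s : α, x < s → s < x' → s ∈ X

/-- The cover of a subset `X`: the sons of elements of `X` that are not themselves in `X`. -/
def cover {α : Type u} [PartialOrder α] (X : Set α) : Set α :=
  {s | ∃ x ∈ X, s ⋖ x} \ X

/-! ### Thicket complexes -/

/-- A sequence of posets `T i` with maps from `T (i + 1)` to subsets of `T i`. -/
structure ComplexData where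
  T : ℕ → Type u
  ord : ∀ i, PartialOrder (T i)
  τ : ∀ i, T (i + 1) → Set (T i)

attribute [instance] ComplexData.ord

/-- The conditions that make such a sequence a thicket complex: every `τ i` is a t-constellation
from the thicket `T (i + 1)` to the convex subtrees of the thicket `T i`, almost all `T i` are
empty, and `T 0` is a singleton. -/
structure ComplexData.IsThicketComplex (D : ComplexData.{u}) : Prop where
  thicket : ∀ i, IsThicket (D.T i)
  convex : ∀ i (t : D.T (i + 1)), IsConvexSubtree (D.τ i t)
  mono : ∀ i (t t' : D.T (i + 1)), t ≤ t' → D.τ i t ⊆ D.τ i t'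
  comparable : ∀ i (t t' : D.T (i + 1)), (D.τ i t ∩ D.τ i t').Nonempty → t ≤ t' ∨ t' ≤ t
  finite_dim : {i | Nonempty (D.T i)}.Finite
  singleton_zero : ∃ x : D.T 0, ∀ y, y = x

structure ThicketComplex extends ComplexData.{u} where
  isThicketComplex : toComplexData.IsThicketComplex

namespace ThicketComplex

/-- The underlying set of the extension `T (i + 1) ◁ T i`: the disjoint sum of `T (i + 1)`, whose
elements are called circles, and of `T i`, whose elements are called dots. -/
inductive Ext (C : ThicketComplex.{u}) (i : ℕ) : Type u
  | circ : C.T (i + 1) → Ext C i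
  | dot : C.T i → Ext C i

/-- The constellation order: circles are ordered as in `T (i + 1)`, dots are added as leaves, and
a dot `s` lies below a circle `t` iff `s ∈ τ i t`. -/
def Ext.Le {C : ThicketComplex.{u}} {i : ℕ} : C.Ext i → C.Ext i → Prop
  | .circ s, .circ t => s ≤ t
  | .dot s, .circ t => s ∈ C.τ i t
  | .dot s, .dot t => s = t
  | .circ _, .dot _ => False

instance (C : ThicketComplex.{u}) (i : ℕ) : PartialOrder (C.Ext i) where
  le := Ext.Le
  le_refl x := by cases x <;> simp [Ext.Le]
  le_trans x y z h h' := by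
    cases x <;> cases y <;> cases z <;> simp only [Ext.Le] at h h' ⊢
    · exact h.trans h'
    · exact C.isThicketComplex.mono i _ _ h' h
    · exact h ▸ h'
    · exact h.trans h'
  le_antisymm x y h h' := by
    cases x <;> cases y <;> simp only [Ext.Le] at h h'
    · rw [le_antisymm h h']
    · rw [h]

/-- The map `f' ◁ f` induced on extensions by a family of maps. -/
def extMap {S T : ThicketComplex.{u}} (f : ∀ i, S.T i → T.T i) (i : ℕ) : S.Ext i → T.Ext i
  | .circ s => .circ (f (i + 1) s)
  | .dot s => .dot (f i s)

/-- A morphism of thicket complexes: a family of embeddings such that all induced maps on the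
extensions are embeddings that preserve binary suprema. Binary suprema in a thicket are a partial
operation, and preservation is meant in the sense of partial operations: `x ∨ y` is defined iff
the supremum of the images is, and then the image of `x ∨ y` is the supremum of the images. -/
@[ext]
structure Hom (S T : ThicketComplex.{u}) where
  toFun : ∀ i, S.T i → T.T i
  le_iff : ∀ i (x y : S.T i), toFun i x ≤ toFun i y ↔ x ≤ y
  ext_le_iff : ∀ i (x y : S.Ext i), extMap toFun i x ≤ extMap toFun i y ↔ x ≤ y
  map_sup : ∀ i (x y z : S.Ext i), IsLUB {x, y} z →
    IsLUB {extMap toFun i x, extMap toFun i y} (extMap toFun i z)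
  sup_defined : ∀ i (x y : S.Ext i),
    (∃ w, IsLUB {extMap toFun i x, extMap toFun i y} w) → ∃ z, IsLUB {x, y} z

theorem extMap_id (S : ThicketComplex.{u}) (i : ℕ) (x : S.Ext i) :
    extMap (fun _ x => x) i x = x := by
  cases x <;> rfl

theorem extMap_comp {S T U : ThicketComplex.{u}} (f : ∀ i, S.T i → T.T i) (g : ∀ i, T.T i → U.T i)
    (i : ℕ) (x : S.Ext i) :
    extMap (fun i x => g i (f i x)) i x = extMap g i (extMap f i x) := by
  cases x <;> rfl

instance : Category ThicketComplex.{u} where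
  Hom := Hom
  id S :=
    { toFun := fun _ x => x
      le_iff := fun _ _ _ => Iff.rfl
      ext_le_iff := fun i x y => by simp only [extMap_id]
      map_sup := fun i x y z h => by simpa only [extMap_id] using h
      sup_defined := fun i x y h => by simpa only [extMap_id] using h }
  comp f g :=
    { toFun := fun i x => g.toFun i (f.toFun i x)
      le_iff := fun i x y => (g.le_iff i _ _).trans (f.le_iff i x y)
      ext_le_iff := fun i x y => by
        simp only [extMap_comp]
        exact (g.ext_le_iff i _ _).trans (f.ext_le_iff i x y)
      map_sup := fun i x y z h => by
        simp only [extMap_comp]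
        exact g.map_sup i _ _ _ (f.map_sup i x y z h)
      sup_defined := fun i x y h => by
        simp only [extMap_comp] at h
        exact f.sup_defined i x y (g.sup_defined i _ _ h) }

end ThicketComplex

/-! ### Positive opetopic cardinals -/

/-- Families of faces with codomain functions `γ` and domain relations `δ`. -/
structure HypergraphData where
  S : ℕ → Type u
  γ : ∀ k, S (k + 1) → S k
  δ : ∀ k, S (k + 1) → Set (S k)

namespace HypergraphData

variable (H : HypergraphData.{u})

/-- The faces of all dimensions; the dimension is the first component. -/
abbrev Face : Type u := Σ k, H.S k

/-- The iterated codomain `γ^(k)`: apply `γ` until the dimension is at most `k`. -/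
def gammaTo (k : ℕ) : H.Face → H.Face
  | ⟨0, p⟩ => ⟨0, p⟩
  | ⟨l + 1, p⟩ => if k ≤ l then gammaTo k ⟨l, H.γ l p⟩ else ⟨l + 1, p⟩

/-- The lower order `<⁻`, the transitive closure of `γ a ∈ δ b` (empty in dimension `0`). -/
def lowerLt : ∀ k, H.S k → H.S k → Prop
  | 0 => fun _ _ => False
  | k + 1 => Relation.TransGen fun a b => H.γ k a ∈ H.δ k b

/-- The upper order `<⁺`, the transitive closure of `∃ α, a ∈ δ α ∧ γ α = b`. -/
def upperLt (k : ℕ) : H.S k → H.S k → Prop :=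
  Relation.TransGen fun a b => ∃ α : H.S (k + 1), a ∈ H.δ k α ∧ H.γ k α = b

/-- The conditions defining positive hypergraphs. -/
structure IsPositiveHypergraph : Prop where
  finite : ∀ k, Finite (H.S k)
  δ_total : ∀ k (a : H.S (k + 1)), (H.δ k a).Nonempty
  δ_zero : ∀ a : H.S 1, ∃ x, H.δ 0 a = {x}
  finite_dim : {k | Nonempty (H.S k)}.Finite

/-- The conditions defining positive opetopic cardinals. -/
structure IsPositiveOpetopicCardinal : Prop extends H.IsPositiveHypergraph where
  nonempty : Nonempty (H.S 0)
  globularity_γ : ∀ k (a : H.S (k + 2)),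
    {H.γ k (H.γ (k + 1) a)} =
      (H.γ k '' H.δ (k + 1) a) \ ⋃ y ∈ H.δ (k + 1) a, H.δ k y
  globularity_δ : ∀ k (a : H.S (k + 2)),
    H.δ k (H.γ (k + 1) a) =
      (⋃ y ∈ H.δ (k + 1) a, H.δ k y) \ (H.γ k '' H.δ (k + 1) a)
  strictness : ∀ k, IsStrictOrder (H.S k) (H.upperLt k)
  linear_zero : ∀ a b : H.S 0, H.upperLt 0 a b ∨ a = b ∨ H.upperLt 0 b a
  disjointness : ∀ k (a b : H.S (k + 1)),
    ¬ ((H.lowerLt (k + 1) a b ∨ H.lowerLt (k + 1) b a) ∧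
      (H.upperLt (k + 1) a b ∨ H.upperLt (k + 1) b a))
  pencil_γ : ∀ k (x : H.S k) (a b : H.S (k + 1)), x = H.γ k a → x = H.γ k b →
    H.upperLt (k + 1) a b ∨ a = b ∨ H.upperLt (k + 1) b a
  pencil_δ : ∀ k (x : H.S k) (a b : H.S (k + 1)), x ∈ H.δ k a → x ∈ H.δ k b →
    H.upperLt (k + 1) a b ∨ a = b ∨ H.upperLt (k + 1) b a

/-- `δ q` as a set of faces. -/
def dom {k : ℕ} (q : H.S (k + 1)) : Set H.Face := Sigma.mk k '' H.δ k q

end HypergraphData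

structure PositiveOpetopicCardinal extends HypergraphData.{u} where
  isPositiveOpetopicCardinal : toHypergraphData.IsPositiveOpetopicCardinal

namespace PositiveOpetopicCardinal

/-- The kernel of a map between faces: the faces whose dimension drops. -/
def ker {P Q : PositiveOpetopicCardinal.{u}} (h : P.Face → Q.Face) : Set P.Face :=
  {q | (h q).1 < q.1}

/-- `ι`-epimorphisms: surjective contraction morphisms. -/
@[ext]
structure IotaEpi (P Q : PositiveOpetopicCardinal.{u}) where
  toFun : P.Face → Q.Face
  dim_le : ∀ q, (toFun q).1 ≤ q.1
  map_γ : ∀ k (q : P.S (k + 1)), toFun ⟨k, P.γ k q⟩ = Q.gammaTo k (toFun ⟨k + 1, q⟩)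
  map_δ : ∀ k (q : P.S (k + 1)) (p : Q.S (k + 1)), toFun ⟨k + 1, q⟩ = ⟨k + 1, p⟩ →
    Set.BijOn toFun (P.dom q \ ker toFun) (Q.dom p)
  map_δ_collapse : ∀ k (q : P.S (k + 1)) (p : Q.S k), toFun ⟨k + 1, q⟩ = ⟨k, p⟩ →
    Set.BijOn toFun (P.dom q \ ker toFun) {⟨k, p⟩}
  map_δ_ker : ∀ k (q : P.S (k + 1)), (toFun ⟨k + 1, q⟩).1 < k → P.dom q ⊆ ker toFun
  surjective : Function.Surjective toFun

theorem gammaTo_of_le (H : HypergraphData.{u}) (k : ℕ) (x : H.Face) (hx : x.1 ≤ k) :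
    H.gammaTo k x = x := by
  obtain ⟨l, p⟩ := x
  cases l with
  | zero => rw [HypergraphData.gammaTo]
  | succ l => rw [HypergraphData.gammaTo, if_neg (by simp at hx; omega)]

theorem gammaTo_succ (H : HypergraphData.{u}) (k : ℕ) (p : H.S (k + 1)) :
    H.gammaTo k ⟨k + 1, p⟩ = ⟨k, H.γ k p⟩ := by
  rw [HypergraphData.gammaTo, if_pos le_rfl]
  exact gammaTo_of_le H k ⟨k, H.γ k p⟩ le_rfl

namespace IotaEpi

variable {P Q R : PositiveOpetopicCardinal.{u}}

def id (P : PositiveOpetopicCardinal.{u}) : IotaEpi P P where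
  toFun x := x
  dim_le _ := le_rfl
  map_γ k q := (gammaTo_succ _ k q).symm
  map_δ k q p h := by
    obtain rfl : q = p := by simpa using h
    have : P.dom q \ ker (fun x : P.Face => x) = P.dom q := by
      ext x; simp [ker]
    rw [this]
    exact Set.bijOn_id _
  map_δ_collapse k q p h := by
    have := congrArg Sigma.fst h
    simp at this
  map_δ_ker k q h := by simp at h
  surjective x := ⟨x, rfl⟩

theorem mem_ker_comp (f : IotaEpi P Q) (g : IotaEpi Q R) (x : P.Face) :
    x ∈ ker (fun x => g.toFun (f.toFun x)) ↔ x ∈ ker f.toFun ∨ f.toFun x ∈ ker g.toFun := by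
  have h1 := f.dim_le x
  have h2 := g.dim_le (f.toFun x)
  simp only [ker, Set.mem_ofPred_eq]
  omega

theorem bijOn_comp (f : IotaEpi P Q) (g : IotaEpi Q R) {A : Set P.Face} {B : Set Q.Face}
    {C : Set R.Face} (hf : Set.BijOn f.toFun (A \ ker f.toFun) B)
    (hg : Set.BijOn g.toFun (B \ ker g.toFun) C) :
    Set.BijOn (fun x => g.toFun (f.toFun x)) (A \ ker fun x => g.toFun (f.toFun x)) C := by
  refine hg.comp (f := f.toFun) ⟨?_, ?_, ?_⟩
  · rintro x ⟨hx, hk⟩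
    rw [mem_ker_comp, not_or] at hk
    exact ⟨hf.mapsTo ⟨hx, hk.1⟩, hk.2⟩
  · rintro x ⟨hx, hk⟩ y ⟨hy, hl⟩ hxy
    rw [mem_ker_comp, not_or] at hk hl
    exact hf.injOn ⟨hx, hk.1⟩ ⟨hy, hl.1⟩ hxy
  · rintro y ⟨hy, hk⟩
    obtain ⟨x, ⟨hx, hl⟩, rfl⟩ := hf.surjOn hy
    exact ⟨x, ⟨hx, by rw [mem_ker_comp, not_or]; exact ⟨hl, hk⟩⟩, rfl⟩

def comp (f : IotaEpi P Q) (g : IotaEpi Q R) : IotaEpi P R where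
  toFun x := g.toFun (f.toFun x)
  dim_le x := (g.dim_le _).trans (f.dim_le x)
  map_γ k q := by
    rw [f.map_γ]
    have hd := f.dim_le ⟨k + 1, q⟩
    generalize f.toFun ⟨k + 1, q⟩ = y at hd
    obtain ⟨l, y⟩ := y
    obtain hl | rfl : l ≤ k ∨ l = k + 1 := by simp only at hd; omega
    · rw [gammaTo_of_le _ _ _ hl, gammaTo_of_le _ _ _ ((g.dim_le _).trans hl)]
    · rw [gammaTo_succ, g.map_γ]
  map_δ k q p h := by
    have h1 := f.dim_le ⟨k + 1, q⟩
    have h2 := g.dim_le (f.toFun ⟨k + 1, q⟩)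
    have h3 : (g.toFun (f.toFun ⟨k + 1, q⟩)).1 = k + 1 := congrArg Sigma.fst h
    rcases hy : f.toFun ⟨k + 1, q⟩ with ⟨l, y⟩
    rw [hy] at h h1 h2 h3
    obtain rfl : l = k + 1 := by simp only at h1 h2; omega
    exact bijOn_comp f g (f.map_δ k q y hy) (g.map_δ k y p h)
  map_δ_collapse k q p h := by
    have h1 := f.dim_le ⟨k + 1, q⟩
    have h2 := g.dim_le (f.toFun ⟨k + 1, q⟩)
    have h3 : (g.toFun (f.toFun ⟨k + 1, q⟩)).1 = k := congrArg Sigma.fst h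
    rcases hy : f.toFun ⟨k + 1, q⟩ with ⟨l, y⟩
    rw [hy] at h h1 h2 h3
    obtain rfl | rfl : l = k + 1 ∨ l = k := by simp only at h1 h2; omega
    · exact bijOn_comp f g (f.map_δ k q y hy) (g.map_δ_collapse k y p h)
    · refine bijOn_comp f g (f.map_δ_collapse l q y hy) ?_
      have : ({⟨l, y⟩} : Set Q.Face) \ ker g.toFun = {⟨l, y⟩} := by
        ext z
        simp only [Set.mem_sdiff, Set.mem_singleton_iff, and_iff_left_iff_imp]
        rintro rfl
        simp [ker, h]
      rw [this, ← h]
      exact Set.bijOn_singleton.2 rfl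
  map_δ_ker k q h := by
    intro x hx
    rw [mem_ker_comp]
    by_contra hn
    rw [not_or] at hn
    have hxk : x.1 = k := by obtain ⟨z, _, rfl⟩ := hx; rfl
    have h1 := f.dim_le ⟨k + 1, q⟩
    rcases hy : f.toFun ⟨k + 1, q⟩ with ⟨l, y⟩
    rw [hy] at h h1
    obtain rfl | rfl | hl : l = k + 1 ∨ l = k ∨ l < k := by simp only at h1; omega
    · exact hn.2 (g.map_δ_ker k y h ((f.map_δ k q y hy).mapsTo ⟨hx, hn.1⟩))
    · have := (f.map_δ_collapse l q y hy).mapsTo ⟨hx, hn.1⟩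
      rw [Set.mem_singleton_iff] at this
      exact hn.2 (by rw [this]; exact h)
    · exact hn.1 (f.map_δ_ker k q (by rw [hy]; exact hl) hx)
  surjective := g.surjective.comp f.surjective

end IotaEpi

/-- The category of positive opetopic cardinals with `ι`-epimorphisms. -/
instance : Category PositiveOpetopicCardinal.{u} where
  Hom := IotaEpi
  id := IotaEpi.id
  comp := IotaEpi.comp

/-! ### From positive opetopic cardinals to thicket complexes -/

theorem lowerLt_irrefl (P : PositiveOpetopicCardinal.{u}) (k : ℕ) (a : P.S k) :
    ¬ P.lowerLt k a a := by
  cases k with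
  | zero => exact fun h => h
  | succ k =>
    intro h
    have key : ∀ b c : P.S (k + 1), P.lowerLt (k + 1) b c → P.upperLt k (P.γ k b) (P.γ k c) :=
      fun b c hbc => by
        induction hbc with
        | single hb => exact .single ⟨_, hb, rfl⟩
        | tail _ hb ih => exact .tail ih ⟨_, hb, rfl⟩
    exact (P.isPositiveOpetopicCardinal.strictness k).irrefl _ (key a a h)

/-- The set `P_i - γ(P_{i+1})`. -/
def StarFace (P : PositiveOpetopicCardinal.{u}) (i : ℕ) : Type u :=
  {p : P.S i // ∀ q, P.γ i q ≠ p}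

/-- `P_i - γ(P_{i+1})` ordered by `≤⁻`. -/
instance (P : PositiveOpetopicCardinal.{u}) (i : ℕ) : PartialOrder (P.StarFace i) where
  le p q := p = q ∨ P.lowerLt i p.1 q.1
  le_refl p := Or.inl rfl
  le_trans p q r := by
    rintro (rfl | h) (rfl | h')
    · exact Or.inl rfl
    · exact Or.inr h'
    · exact Or.inr h
    · cases i with
      | zero => exact h.elim
      | succ i => exact Or.inr (Relation.TransGen.trans h h')
  le_antisymm p q := by
    rintro (rfl | h) (h' | h')
    · rfl
    · rfl
    · exact h'.symm
    · cases i with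
      | zero => exact h.elim
      | succ i => exact (P.lowerLt_irrefl (i + 1) p.1 (Relation.TransGen.trans h h')).elim

/-- The sequence `P^*` of posets and maps assigned to `P`. -/
def star (P : PositiveOpetopicCardinal.{u}) : ComplexData.{u} where
  T := P.StarFace
  ord _ := inferInstance
  τ i p := {s | P.upperLt i s.1 (P.γ i p.1)}

/-- `g` is the family of maps `f^*` assigned to `f`: for `q` in `Q_i - γ(Q_{i+1})`, `g q` is the
unique element `p` of `P_i - γ(P_{i+1})` with `f p = q`. -/
def IsStarMap {P Q : PositiveOpetopicCardinal.{u}} (f : P ⟶ Q)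
    (g : ∀ i, Q.StarFace i → P.StarFace i) : Prop :=
  ∀ i (q : Q.StarFace i) (p : P.StarFace i), g i q = p ↔ f.toFun ⟨i, p.1⟩ = ⟨i, q.1⟩

end PositiveOpetopicCardinal

/-! ### From thicket complexes to positive opetopic cardinals -/

namespace ThicketComplex

variable (C : ThicketComplex.{u})

/-- The set of circles in `T (i + 1) ◁ T i` given by the leaves of `T (i + 2) ◁ T (i + 1)` over
`p`. The leaves are exactly the dots, since the values of `τ` are non-empty. -/
def leavesCirc {i : ℕ} (p : C.Ext (i + 1)) : Set (C.Ext i) :=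
  {x | ∃ s : C.T (i + 1), Ext.dot s ≤ p ∧ x = Ext.circ s}

theorem exists_sup {i : ℕ} (p : C.Ext (i + 1)) : ∃ z, IsLUB (C.leavesCirc p) z := by
  suffices ∃ z, IsGreatest (C.leavesCirc p) z from ⟨_, this.choose_spec.isLUB⟩
  cases p with
  | dot t =>
    refine ⟨.circ t, ⟨t, le_rfl, rfl⟩, ?_⟩
    rintro _ ⟨s, hs, rfl⟩
    exact (show s = t from hs).le
  | circ t =>
    obtain ⟨⟨m, hm, hm'⟩, -⟩ := C.isThicketComplex.convex _ t
    refine ⟨.circ m, ⟨m, hm, rfl⟩, ?_⟩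
    rintro _ ⟨s, hs, rfl⟩
    exact hm' hs

/-- The family of faces `T^*` assigned to `T`, with its codomain and domain operations. -/
noncomputable def star : HypergraphData.{u} where
  S := C.Ext
  γ _ p := (C.exists_sup p).choose
  δ _ p := cover (C.leavesCirc p)

/-- The set `δγ^(j+1)(t)` of `j`-dimensional faces, which is `{t}` if `t` has dimension `j`. -/
def domTo (j : ℕ) (t : C.star.Face) : Set (C.Ext j) :=
  {x | t = ⟨j, x⟩ ∨ ∃ r : C.Ext (j + 1), C.star.gammaTo (j + 1) t = ⟨j + 1, r⟩ ∧ x ∈ C.star.δ j r}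

/-- The elements `s` of `S_j^*` whose image under the map induced by `f` lies below some element
of `δγ^(j+1)(t)`. -/
def below {S T : ThicketComplex.{u}} (f : S ⟶ T) (t : T.star.Face) (j : ℕ) : Set (S.Ext j) :=
  {s | ∃ x ∈ T.domTo j t, extMap f.toFun j s ≤ x}

/-- `h` is the map `f^*` assigned to `f`: the dimension `j` of `h t` is the largest one for which
there is an element `s` of `S_j^*` whose image lies below `δγ^(j+1)(t)`, and `h t` is the largest
such `s`. -/
def IsStarMap {S T : ThicketComplex.{u}} (f : S ⟶ T) (h : T.star.Face → S.star.Face) : Prop :=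
  ∀ (t : T.star.Face) (j : ℕ) (s : S.Ext j), h t = ⟨j, s⟩ ↔
    IsGreatest {j | j ≤ t.1 ∧ (below f t j).Nonempty} j ∧ IsGreatest (below f t j) s

end ThicketComplex

/-! ### The two functors -/

/-- The functor `C ⥤ Dᵒᵖ` with the given contravariant action on objects and morphisms. -/
def contraFunctor {C D : Type*} [Category C] [Category D] (obj : C → D)
    (map : ∀ {X Y : C}, (X ⟶ Y) → (obj Y ⟶ obj X)) (map_id : ∀ X : C, map (𝟙 X) = 𝟙 (obj X))
    (map_comp : ∀ {X Y Z : C} (f : X ⟶ Y) (g : Y ⟶ Z), map (f ≫ g) = map g ≫ map f) :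
    C ⥤ Dᵒᵖ where
  obj X := Opposite.op (obj X)
  map f := (map f).op
  map_id X := by rw [map_id]; rfl
  map_comp f g := by rw [map_comp]; rfl

/-- `F` is the functor `(-)^*` from positive opetopic cardinals to thicket complexes: all `P^*` are
thicket complexes, all `f^*` are morphisms of thicket complexes and are functorial in `f`, and `F`
is given by `P ↦ P^*` and `f ↦ f^*`. -/
def IsStarOfCardinals (F : PositiveOpetopicCardinal.{u} ⥤ ThicketComplex.{u}ᵒᵖ) : Prop :=
  ∃ (isComplex : ∀ P : PositiveOpetopicCardinal.{u}, P.star.IsThicketComplex)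
    (map : ∀ {P Q : PositiveOpetopicCardinal.{u}}, (P ⟶ Q) →
      ((⟨Q.star, isComplex Q⟩ : ThicketComplex.{u}) ⟶ ⟨P.star, isComplex P⟩))
    (map_id : ∀ P : PositiveOpetopicCardinal.{u}, map (𝟙 P) = 𝟙 _)
    (map_comp : ∀ {P Q R : PositiveOpetopicCardinal.{u}} (f : P ⟶ Q) (g : Q ⟶ R),
      map (f ≫ g) = map g ≫ map f),
    (∀ {P Q : PositiveOpetopicCardinal.{u}} (f : P ⟶ Q),
      PositiveOpetopicCardinal.IsStarMap f (map f).toFun) ∧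
    F = contraFunctor (fun P => ⟨P.star, isComplex P⟩) map map_id map_comp

/-- `G` is the functor `(-)^*` from thicket complexes to positive opetopic cardinals: all `T^*` are
positive opetopic cardinals, all `f^*` are `ι`-epimorphisms and are functorial in `f`, and `G` is
given by `T ↦ T^*` and `f ↦ f^*`. -/
def IsStarOfComplexes (G : ThicketComplex.{u}ᵒᵖ ⥤ PositiveOpetopicCardinal.{u}) : Prop :=
  ∃ (isCardinal : ∀ T : ThicketComplex.{u}, T.star.IsPositiveOpetopicCardinal)
    (map : ∀ {S T : ThicketComplex.{u}}, (S ⟶ T) →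
      ((⟨T.star, isCardinal T⟩ : PositiveOpetopicCardinal.{u}) ⟶ ⟨S.star, isCardinal S⟩))
    (map_id : ∀ T : ThicketComplex.{u}, map (𝟙 T) = 𝟙 _)
    (map_comp : ∀ {S T U : ThicketComplex.{u}} (f : S ⟶ T) (g : T ⟶ U),
      map (f ≫ g) = map g ≫ map f),
    (∀ {S T : ThicketComplex.{u}} (f : S ⟶ T), ThicketComplex.IsStarMap f (map f).toFun) ∧
    G = (contraFunctor (fun T => ⟨T.star, isCardinal T⟩) map map_id map_comp).leftOp

end OpeDuality

/-! Both structures encode the same forests. In a thicket complex, comparability of elements with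
overlapping constellations makes every extension `T (i + 1) ◁ T i` a forest: its principal up-sets
are chains. The dots below a face p cut out a convex subtree `leavesCirc p` of the extension one
dimension lower; its top is the codomain of p and its cover is the domain. Globularity then reduces
to `IsForest.partition`, because the trees `leavesCirc y` with y in the domain of a partition
`leavesCirc (cod a)`.

Conversely, the building blocks of a positive opetopic cardinal are the faces that are not
codomains. By pencil linearity such a face is determined by its codomain, and also by any one
element of its domain. `hasNormalForms` presents each face of positive dimension as the pasting of
the blocks below it. Consequently `≤⁺` is a forest order in which the elements covered by γ s, for a
block s, are exactly those of δ s. Sending a dot s to s and a circle s to γ s (`ofExt`) then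
identifies the extensions of P^* with the face sets of P, together with γ and δ.

On morphisms the duality is a Galois connection with a partial adjoint. An ι-epimorphism f,
restricted to the faces whose dimension it keeps, is a partial monotone map with up-closed domain.
Choosing preimages of blocks gives its left adjoint (`liftExt_le_iff`), which therefore preserves
suprema. In the other direction, if an embedding respects suprema, the faces mapped below t are
directed, so they have a greatest element as soon as there are any; this is the value at t, and
otherwise the value at the codomain of t is taken (`pull`). Naturality of the two comparison
isomorphisms expresses that these adjoints determine each other. -/

namespace OpeDuality

/-! ### Finite forests -/

section Forest

variable {α : Type u} [PartialOrder α]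

/-- All principal up-sets are chains. -/
def IsForest (α : Type u) [PartialOrder α] : Prop :=
  ∀ x a b : α, x ≤ a → x ≤ b → a ≤ b ∨ b ≤ a

theorem IsForest.exists_isLUB [Finite α] (h : IsForest α) {x y w : α} (hx : x ≤ w) (hy : y ≤ w) :
    ∃ z, IsLUB {x, y} z := by
  obtain ⟨m, hm⟩ := (Set.toFinite (upperBounds {x, y})).exists_minimal
    ⟨w, by rintro _ (rfl | rfl) <;> assumption⟩
  refine ⟨m, hm.1, fun u hu => ?_⟩
  rcases h x m u (hm.1 (by simp)) (hu (by simp)) with h' | h'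
  · exact h'
  · exact hm.2 hu h'

/-- A set with a lower bound z sits inside the up-set of z, which is a chain; this settles the
condition on infima. -/
theorem IsForest.isThicket [Finite α] (h : IsForest α) : IsThicket α := by
  refine ⟨inferInstance, fun p => ⟨inferInstance, ⟨⟨p, le_rfl⟩⟩, fun x y => ?_, ?_⟩⟩
  · have hp : IsForest (Set.Iic p) := fun x a b => h x a b
    exact hp.exists_isLUB (w := ⟨p, le_rfl⟩) x.2 y.2
  · rintro X ⟨z, hz⟩ a ha b hb -
    exact h z.1 a.1 b.1 (hz.1 ha) (hz.1 hb)

/-! ### Covers of convex subtrees -/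

theorem exists_mem_cover [Finite α] {X : Set α} {x z : α} (hz : z ∈ X) (hx : x ∉ X)
    (h : x ≤ z) : ∃ c ∈ cover X, x ≤ c := by
  obtain ⟨m, hm⟩ := (Set.toFinite {y | y ∈ X ∧ x ≤ y}).exists_minimal ⟨z, hz, h⟩
  have hlt : x < m := lt_of_le_of_ne hm.1.2 (by rintro rfl; exact hx hm.1.1)
  obtain ⟨c, hc⟩ := (Set.toFinite {y | x ≤ y ∧ y < m}).exists_maximal ⟨x, le_rfl, hlt⟩
  refine ⟨c, ⟨⟨m, hm.1.1, hc.1.2, fun d hd hd' => ?_⟩, fun hcX => ?_⟩, hc.1.1⟩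
  · exact hd.not_ge (hc.2 ⟨hc.1.1.trans hd.le, hd'⟩ hd.le)
  · exact hc.1.2.not_ge (hm.2 ⟨hcX, hc.1.1⟩ hc.1.2.le)

theorem IsConvexSubtree.mem_of_le {X : Set α} (hX : IsConvexSubtree X) {x s y : α} (hx : x ∈ X)
    (hy : y ∈ X) (h : x ≤ s) (h' : s ≤ y) : s ∈ X := by
  rcases h.eq_or_lt with rfl | h
  · exact hx
  rcases h'.eq_or_lt with rfl | h'
  · exact hy
  exact hX.2 x hx y hy s h h'

theorem IsForest.le_of_covBy (hF : IsForest α) {x y z : α} (h : x ⋖ y) (h' : x < z) : y ≤ z := by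
  rcases hF x y z h.1.le h'.le with h1 | h1
  · exact h1
  · rcases h1.eq_or_lt with rfl | h1
    · exact le_rfl
    · exact (h.2 h' h1).elim

theorem IsForest.covBy_unique (hF : IsForest α) {x y z : α} (h : x ⋖ y) (h' : x ⋖ z) : y = z :=
  le_antisymm (hF.le_of_covBy h h'.1) (hF.le_of_covBy h' h.1)

/-- Elements c and d above a common w are comparable. If c < d, the parent of c in X lies below d,
so d is caught between two members of X and convexity puts it into X. -/
theorem IsForest.cover_unique (hF : IsForest α) {X : Set α} (hX : IsConvexSubtree X) {c d w : α}
    (hc : c ∈ cover X) (hd : d ∈ cover X) (h : w ≤ c) (h' : w ≤ d) : c = d := by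
  wlog hcd : c ≤ d generalizing c d
  · exact (this hd hc h' h ((hF w c d h h').resolve_left hcd)).symm
  obtain ⟨⟨l, hl, hcl⟩, hcX⟩ := hc
  obtain ⟨⟨m, hm, hdm⟩, hdX⟩ := hd
  rcases hcd.eq_or_lt with h1 | h1
  · exact h1
  · exact (hdX (hX.mem_of_le hl hm (hF.le_of_covBy hcl h1) hdm.1.le)).elim

theorem IsConvexSubtree.lt_of_mem_cover {X : Set α} {m c : α} (hm : IsGreatest X m)
    (hc : c ∈ cover X) : c < m := by
  obtain ⟨⟨l, hl, hcl⟩, -⟩ := hc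
  exact hcl.1.trans_le (hm.2 hl)

theorem exists_covBy_le [Finite α] {x z : α} (h : x < z) : ∃ y, x ⋖ y ∧ y ≤ z := by
  obtain ⟨c, hc⟩ := (Set.toFinite {y | x < y ∧ y ≤ z}).exists_minimal ⟨z, h, le_rfl⟩
  exact ⟨c, ⟨hc.1.1, fun d hd hd' => hd'.not_ge (hc.2 ⟨hd, hd'.le.trans hc.1.2⟩ hd'.le)⟩, hc.1.2⟩

theorem transGen_covBy [Finite α] {x z : α} (h : x < z) : Relation.TransGen (· ⋖ ·) x z := by
  induction x using (wellFounded_gt (α := α)).induction with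
  | _ x ih =>
    obtain ⟨y, hy, hyz⟩ := exists_covBy_le h
    rcases hyz.eq_or_lt with rfl | hlt
    · exact .single hy
    · exact .head hy (ih y hy.1 hlt)

/-- Tops and covers of a convex subtree that is partitioned into convex subtrees. -/
theorem IsForest.partition [Finite α] (hF : IsForest α) {ι : Type*} {J : Set ι} {Z : Set α} {m : α}
    (hZ : IsConvexSubtree Z) (hm : IsGreatest Z m) {Y : ι → Set α} {t : ι → α}
    (hY : ∀ j ∈ J, IsConvexSubtree (Y j)) (ht : ∀ j ∈ J, IsGreatest (Y j) (t j))
    (hsub : ∀ j ∈ J, Y j ⊆ Z) (hcov : ∀ z ∈ Z, ∃ j ∈ J, z ∈ Y j)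
    (hdisj : ∀ j ∈ J, ∀ k ∈ J, ∀ z, z ∈ Y j → z ∈ Y k → j = k) :
    {m} = (t '' J) \ ⋃ j ∈ J, cover (Y j) ∧ cover Z = (⋃ j ∈ J, cover (Y j)) \ (t '' J) := by
  -- A covering edge can leave a block only at the top of that block.
  have htop : ∀ j ∈ J, ∀ z ∈ Y j, ∀ w, z ⋖ w → w ∈ Z → z = t j ∨ w ∈ Y j := by
    intro j hj z hz w hzw hw
    rcases ((ht j hj).2 hz).eq_or_lt with h | h
    · exact Or.inl h
    · exact Or.inr ((hY j hj).mem_of_le hz (ht j hj).1 hzw.1.le (hF.le_of_covBy hzw h))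
  constructor
  · ext x
    simp only [Set.mem_singleton_iff, Set.mem_sdiff, Set.mem_image, Set.mem_iUnion, not_exists]
    constructor
    · rintro rfl
      obtain ⟨j, hj, hx⟩ := hcov x hm.1
      refine ⟨⟨j, hj, le_antisymm (hm.2 (hsub j hj (ht j hj).1)) ((ht j hj).2 hx)⟩, ?_⟩
      rintro k hk ⟨⟨l, hl, hxl⟩, -⟩
      exact hxl.1.not_ge (hm.2 (hsub k hk hl))
    · rintro ⟨⟨j, hj, rfl⟩, h⟩
      have hjZ := hsub j hj (ht j hj).1
      by_contra hne
      obtain ⟨w, hw, hwm⟩ := exists_covBy_le (lt_of_le_of_ne (hm.2 hjZ) hne)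
      have hwZ := hZ.mem_of_le hjZ hm.1 hw.1.le hwm
      obtain ⟨k, hk, hwk⟩ := hcov w hwZ
      refine h k hk ⟨⟨w, hwk, hw⟩, fun hmem => ?_⟩
      obtain rfl := hdisj j hj k hk _ (ht j hj).1 hmem
      exact hw.1.not_ge ((ht j hj).2 hwk)
  · ext x
    simp only [Set.mem_sdiff, Set.mem_image, Set.mem_iUnion, not_exists, exists_prop, not_and]
    constructor
    · rintro ⟨⟨l, hl, hxl⟩, hx⟩
      obtain ⟨j, hj, hlj⟩ := hcov l hl
      refine ⟨⟨j, hj, ⟨l, hlj, hxl⟩, fun h => hx (hsub j hj h)⟩, ?_⟩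
      rintro k hk rfl
      exact hx (hsub k hk (ht k hk).1)
    · rintro ⟨⟨j, hj, ⟨l, hl, hxl⟩, hx⟩, h⟩
      refine ⟨⟨l, hsub j hj hl, hxl⟩, fun hxZ => ?_⟩
      obtain ⟨k, hk, hxk⟩ := hcov x hxZ
      rcases htop k hk x hxk l hxl (hsub j hj hl) with h1 | h1
      · exact h k hk h1.symm
      · obtain rfl := hdisj j hj k hk l hl h1
        exact hx hxk

end Forest

/-! ### The positive opetopic cardinal of a thicket complex -/

namespace ThicketComplex

variable (C : ThicketComplex.{u})

instance finite_T (i : ℕ) : Finite (C.T i) := (C.isThicketComplex.thicket i).1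

instance finite_ext (i : ℕ) : Finite (C.Ext i) := by
  refine Finite.of_surjective (α := C.T (i + 1) ⊕ C.T i) (Sum.elim Ext.circ Ext.dot) ?_
  rintro (t | s)
  · exact ⟨.inl t, rfl⟩
  · exact ⟨.inr s, rfl⟩

variable {C} {i : ℕ}

@[simp] theorem circ_le_circ {s t : C.T (i + 1)} : (Ext.circ s : C.Ext i) ≤ .circ t ↔ s ≤ t :=
  Iff.rfl

@[simp] theorem dot_le_circ {s : C.T i} {t : C.T (i + 1)} :
    (Ext.dot s : C.Ext i) ≤ .circ t ↔ s ∈ C.τ i t :=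
  Iff.rfl

@[simp] theorem dot_le_dot {s t : C.T i} : (Ext.dot s : C.Ext i) ≤ .dot t ↔ s = t :=
  Iff.rfl

@[simp] theorem not_circ_le_dot {s : C.T (i + 1)} {t : C.T i} :
    ¬ (Ext.circ s : C.Ext i) ≤ .dot t :=
  fun h => h

theorem not_lt_dot {x : C.Ext i} {t : C.T i} : ¬ x < .dot t := by
  intro h
  cases x with
  | circ s => exact not_circ_le_dot h.le
  | dot s => exact h.ne (congrArg _ (dot_le_dot.1 h.le))

theorem dot_lt_circ {s : C.T i} {t : C.T (i + 1)} :
    (Ext.dot s : C.Ext i) < .circ t ↔ s ∈ C.τ i t :=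
  ⟨fun h => h.le, fun h => lt_of_le_of_ne h (by simp)⟩

theorem circ_lt_circ {s t : C.T (i + 1)} : (Ext.circ s : C.Ext i) < .circ t ↔ s < t := by
  simp only [lt_iff_le_not_ge, circ_le_circ]

theorem eq_circ_of_circ_le {s : C.T (i + 1)} {x : C.Ext i} (h : .circ s ≤ x) :
    ∃ t, x = .circ t := by
  cases x with
  | circ t => exact ⟨t, rfl⟩
  | dot t => exact (not_circ_le_dot h).elim

/-- The non-empty set `τ x` is contained in both `τ a` and `τ b`, so these overlap and a, b are
comparable; dimension 0 is a point. -/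
theorem isForest_T (C : ThicketComplex.{u}) (i : ℕ) : IsForest (C.T i) := by
  intro x a b ha hb
  cases i with
  | zero =>
    obtain ⟨z, hz⟩ := C.isThicketComplex.singleton_zero
    rw [hz a, hz b]
    exact Or.inl le_rfl
  | succ i =>
    obtain ⟨⟨m, hm, -⟩, -⟩ := C.isThicketComplex.convex i x
    exact C.isThicketComplex.comparable i a b
      ⟨m, C.isThicketComplex.mono i _ _ ha hm, C.isThicketComplex.mono i _ _ hb hm⟩

theorem isForest_ext (C : ThicketComplex.{u}) (i : ℕ) : IsForest (C.Ext i) := by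
  rintro (x | x) (a | a) (b | b) ha hb <;>
    simp only [circ_le_circ, dot_le_circ, dot_le_dot, not_circ_le_dot] at ha hb ⊢
  · exact isForest_T C _ x a b ha hb
  · exact C.isThicketComplex.comparable i a b ⟨x, ha, hb⟩
  · exact Or.inr (hb ▸ ha)
  · exact Or.inl (ha ▸ hb)
  · exact Or.inl (ha ▸ hb)

/-! ### Codomains and domains as tops and covers of convex subtrees -/

theorem circ_mem_leavesCirc {p : C.Ext (i + 1)} {s : C.T (i + 1)} :
    .circ s ∈ C.leavesCirc p ↔ .dot s ≤ p := by
  constructor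
  · rintro ⟨s', hs', h⟩
    cases h
    exact hs'
  · exact fun h => ⟨s, h, rfl⟩

theorem dot_notMem_leavesCirc {p : C.Ext (i + 1)} {s : C.T i} : .dot s ∉ C.leavesCirc p := by
  rintro ⟨_, -, h⟩
  cases h

theorem isConvexSubtree_leavesCirc (p : C.Ext (i + 1)) : IsConvexSubtree (C.leavesCirc p) := by
  cases p with
  | dot t =>
    have : C.leavesCirc (.dot t) = {.circ t} := by
      ext x
      cases x with
      | circ s => rw [circ_mem_leavesCirc]; simp
      | dot s => simp [dot_notMem_leavesCirc]
    rw [this]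
    refine ⟨⟨_, isGreatest_singleton⟩, ?_⟩
    rintro x rfl y rfl s h h'
    exact (h.not_gt h').elim
  | circ t =>
    obtain ⟨⟨m, hm, hm'⟩, hc⟩ := C.isThicketComplex.convex _ t
    refine ⟨⟨.circ m, circ_mem_leavesCirc.2 hm, ?_⟩, ?_⟩
    · rintro _ ⟨s, hs, rfl⟩
      exact hm' hs
    · rintro _ ⟨x, hx, rfl⟩ _ ⟨y, hy, rfl⟩ s h h'
      obtain ⟨s, rfl⟩ := eq_circ_of_circ_le h.le
      exact circ_mem_leavesCirc.2 (hc x hx y hy s (circ_lt_circ.1 h) (circ_lt_circ.1 h'))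

variable (C) in
/-- The codomain operation of `T^*`. -/
noncomputable def cod (p : C.Ext (i + 1)) : C.Ext i := C.star.γ i p

variable (C) in
/-- The domain operation of `T^*`. -/
def bd (p : C.Ext (i + 1)) : Set (C.Ext i) := C.star.δ i p

theorem cod_isGreatest (p : C.Ext (i + 1)) : IsGreatest (C.leavesCirc p) (C.cod p) := by
  obtain ⟨m, hm⟩ := (isConvexSubtree_leavesCirc p).1
  have : C.cod p = m := (C.exists_sup p).choose_spec.unique hm.isLUB
  rw [this]
  exact hm

theorem cod_eq {p : C.Ext (i + 1)} {m : C.Ext i} (h : IsGreatest (C.leavesCirc p) m) :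
    C.cod p = m :=
  (cod_isGreatest p).unique h

theorem cod_dot (s : C.T (i + 1)) : C.cod (.dot s : C.Ext (i + 1)) = .circ s := by
  refine cod_eq ⟨circ_mem_leavesCirc.2 le_rfl, ?_⟩
  rintro _ ⟨t, ht, rfl⟩
  exact (dot_le_dot.1 ht).le

theorem exists_cod_eq_circ (p : C.Ext (i + 1)) :
    ∃ s : C.T (i + 1), .dot s ≤ p ∧ C.cod p = .circ s := by
  obtain ⟨s, hs, h⟩ := (cod_isGreatest p).1
  exact ⟨s, hs, h⟩

theorem cod_ne_dot (p : C.Ext (i + 1)) (s : C.T i) : C.cod p ≠ .dot s := by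
  obtain ⟨t, -, h⟩ := exists_cod_eq_circ p
  rw [h]
  simp

theorem leavesCirc_mono {p q : C.Ext (i + 1)} (h : p ≤ q) : C.leavesCirc p ⊆ C.leavesCirc q := by
  rintro _ ⟨s, hs, rfl⟩
  exact ⟨s, hs.trans h, rfl⟩

theorem mem_bd_dot {s : C.T (i + 1)} {x : C.Ext i} :
    x ∈ C.bd (.dot s : C.Ext (i + 1)) ↔ x ⋖ .circ s := by
  constructor
  · rintro ⟨⟨_, ⟨t, ht, rfl⟩, h⟩, -⟩
    rwa [← dot_le_dot.1 ht]
  · refine fun h => ⟨⟨_, circ_mem_leavesCirc.2 le_rfl, h⟩, ?_⟩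
    rintro ⟨t, ht, rfl⟩
    rw [dot_le_dot.1 ht] at h
    exact h.1.ne rfl

theorem lt_cod_of_mem_bd {p : C.Ext (i + 1)} {x : C.Ext i} (h : x ∈ C.bd p) :
    x < C.cod p :=
  IsConvexSubtree.lt_of_mem_cover (cod_isGreatest p) h

theorem cod_mono {p q : C.Ext (i + 1)} (h : p ≤ q) : C.cod p ≤ C.cod q :=
  (cod_isGreatest q).2 (leavesCirc_mono h (cod_isGreatest p).1)

/-- The order `<⁺` on `T^*` is the constellation order. -/
theorem star_upperLt {x y : C.Ext i} : C.star.upperLt i x y ↔ x < y := by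
  constructor
  · intro h
    induction h with
    | single h => obtain ⟨p, hp, rfl⟩ := h; exact lt_cod_of_mem_bd hp
    | tail _ h ih => obtain ⟨p, hp, rfl⟩ := h; exact ih.trans (lt_cod_of_mem_bd hp)
  · intro h
    -- Only circles lie strictly above anything. The edge from a to `circ b` is realised by the face
    -- `dot b`, whose subtree is the single circle `circ b`.
    have key : ∀ a b : C.Ext i, a ⋖ b → ∃ p : C.Ext (i + 1), a ∈ C.bd p ∧ C.cod p = b := by
      intro a b hab
      cases b with
      | dot b => exact (not_lt_dot hab.1).elim
      | circ b => exact ⟨.dot b, mem_bd_dot.2 hab, cod_dot b⟩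
    exact Relation.TransGen.mono key _ _ (transGen_covBy h)

theorem exists_dot_le (x : C.Ext i) : ∃ s : C.T i, .dot s ≤ x := by
  cases x with
  | dot s => exact ⟨s, le_rfl⟩
  | circ t =>
    obtain ⟨⟨m, hm, -⟩, -⟩ := C.isThicketComplex.convex _ t
    exact ⟨m, hm⟩

theorem ext_zero_linear (x y : C.Ext 0) : x ≤ y ∨ y ≤ x := by
  obtain ⟨z, hz⟩ := C.isThicketComplex.singleton_zero
  obtain ⟨s, hs⟩ := exists_dot_le x
  obtain ⟨t, ht⟩ := exists_dot_le y
  rw [hz s] at hs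
  rw [hz t] at ht
  exact isForest_ext C 0 _ x y hs ht

/-- Together with `bd_unique`, this distributes what lies below `cod p` outside `leavesCirc p` among
the down-sets of the elements of `bd p`. -/
theorem exists_mem_bd_of_le {p : C.Ext (i + 1)} {x : C.Ext i} (h : x ≤ C.cod p)
    (hx : x ∉ C.leavesCirc p) : ∃ c ∈ C.bd p, x ≤ c :=
  exists_mem_cover (cod_isGreatest p).1 hx h

theorem bd_unique {p : C.Ext (i + 1)} {w c d : C.Ext i} (hc : c ∈ C.bd p)
    (hd : d ∈ C.bd p) (h : w ≤ c) (h' : w ≤ d) : c = d :=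
  (isForest_ext C i).cover_unique (isConvexSubtree_leavesCirc p) hc hd h h'

theorem bd_nonempty (p : C.Ext (i + 1)) : (C.bd p).Nonempty := by
  obtain ⟨s, hs⟩ := exists_dot_le (C.cod p)
  obtain ⟨c, hc, -⟩ := exists_mem_bd_of_le hs dot_notMem_leavesCirc
  exact ⟨c, hc⟩

/-- A dot is never in `leavesCirc a`, so each dot below `cod a` lies below exactly one y in `bd a`.
Hence the subtrees of these y partition the subtree of `cod a`. -/
theorem star_globularity (a : C.Ext (i + 2)) :
    {C.cod (C.cod a)} =
      (C.cod '' C.bd a) \ (⋃ y ∈ C.bd a, C.bd y) ∧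
    C.bd (C.cod a) =
      (⋃ y ∈ C.bd a, C.bd y) \ (C.cod '' C.bd a) := by
  refine (isForest_ext C i).partition (isConvexSubtree_leavesCirc (C.cod a))
    (cod_isGreatest _) (Y := fun y => C.leavesCirc (y : C.Ext (i + 1)))
    (fun y _ => isConvexSubtree_leavesCirc y) (fun y _ => cod_isGreatest y)
    (fun y hy => leavesCirc_mono (lt_cod_of_mem_bd hy).le) ?_ ?_
  · rintro _ ⟨s, hs, rfl⟩
    obtain ⟨c, hc, h⟩ := exists_mem_bd_of_le hs dot_notMem_leavesCirc
    exact ⟨c, hc, s, h, rfl⟩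
  · rintro y hy z hz _ ⟨s, hs, rfl⟩ h
    exact bd_unique hy hz hs (circ_mem_leavesCirc.1 h)

theorem cod_lt_of_star_lowerLt {a b : C.Ext (i + 1)} (h : C.star.lowerLt (i + 1) a b) :
    C.cod a < C.cod b := by
  induction h with
  | single h => exact lt_cod_of_mem_bd h
  | tail _ h ih => exact ih.trans (lt_cod_of_mem_bd h)

/-- If a ≤ b, then `cod a` is in `leavesCirc b`. The last step of the lower chain gives c with `cod
a ≤ cod c` and `cod c` in `bd b`; convexity pulls `cod c` into `leavesCirc b`, which a cover avoids.
-/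
theorem not_le_of_star_lowerLt {a b : C.Ext (i + 1)} (h : C.star.lowerLt (i + 1) a b) :
    ¬ a ≤ b := by
  intro hab
  have hmem : C.cod a ∈ C.leavesCirc b := leavesCirc_mono hab (cod_isGreatest a).1
  have : ∃ c, C.cod a ≤ C.cod c ∧ C.cod c ∈ C.bd b := by
    rcases Relation.TransGen.tail'_iff.1 h with ⟨c, hac, hcb⟩
    refine ⟨c, ?_, hcb⟩
    rcases Relation.reflTransGen_iff_eq_or_transGen.1 hac with rfl | hac
    · exact le_rfl
    · exact (cod_lt_of_star_lowerLt hac).le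
  obtain ⟨c, hac, hc⟩ := this
  exact hc.2 ((isConvexSubtree_leavesCirc b).mem_of_le hmem (cod_isGreatest b).1 hac
    (lt_cod_of_mem_bd hc).le)

theorem star_isPositiveOpetopicCardinal (C : ThicketComplex.{u}) :
    C.star.IsPositiveOpetopicCardinal where
  finite k := finite_ext C k
  δ_total k a := bd_nonempty a
  δ_zero a := by
    obtain ⟨c, hc⟩ := bd_nonempty a
    refine ⟨c, Set.eq_singleton_iff_unique_mem.2 ⟨hc, fun d hd => ?_⟩⟩
    rcases ext_zero_linear c d with h | h
    · exact (bd_unique hc hd le_rfl h).symm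
    · exact bd_unique hd hc le_rfl h
  finite_dim := by
    have h := C.isThicketComplex.finite_dim
    refine (h.union (h.preimage (f := fun i => i + 1) (by simp))).subset ?_
    rintro k ⟨t | s⟩
    · exact Or.inr ⟨t⟩
    · exact Or.inl ⟨s⟩
  nonempty := ⟨.dot C.isThicketComplex.singleton_zero.choose⟩
  globularity_γ k a := (star_globularity a).1
  globularity_δ k a := (star_globularity a).2
  strictness k :=
    { irrefl := fun a h => (star_upperLt.1 h).ne rfl
      trans := fun _ _ _ => Relation.TransGen.trans }
  linear_zero a b := by
    erw [star_upperLt, star_upperLt]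
    rcases ext_zero_linear a b with h | h
    · rcases h.eq_or_lt with h | h <;> simp [h]
    · rcases h.eq_or_lt with h | h <;> simp [h]
  disjointness k a b := by
    erw [star_upperLt, star_upperLt]
    rintro ⟨h | h, h' | h'⟩
    · exact not_le_of_star_lowerLt h h'.le
    · exact (cod_lt_of_star_lowerLt h).not_ge (cod_mono h'.le)
    · exact (cod_lt_of_star_lowerLt h).not_ge (cod_mono h'.le)
    · exact not_le_of_star_lowerLt h h'.le
  pencil_γ k x a b ha hb := by
    erw [star_upperLt, star_upperLt]
    -- The common codomain is a circle `circ s`, so a and b both lie above `dot s`, whose up-set is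
    -- a chain.
    obtain ⟨s, hs, hsa⟩ := exists_cod_eq_circ (a : C.Ext (k + 1))
    obtain ⟨t, ht, htb⟩ := exists_cod_eq_circ (b : C.Ext (k + 1))
    have hst : s = t := by
      have : (Ext.circ s : C.Ext k) = .circ t := hsa.symm.trans (ha.symm.trans (hb.trans htb))
      cases this
      rfl
    subst hst
    rcases isForest_ext C (k + 1) _ a b hs ht with h | h
    · rcases h.eq_or_lt with h | h <;> simp [h]
    · rcases h.eq_or_lt with h | h <;> simp [h]
  pencil_δ k x a b ha hb := by
    erw [star_upperLt, star_upperLt]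
    -- In a forest x has at most one cover, so the circles over x coming from a and from b agree,
    -- and a, b lie above the same dot.
    obtain ⟨⟨_, ⟨s, hs, rfl⟩, hxs⟩, -⟩ := ha
    obtain ⟨⟨_, ⟨t, ht, rfl⟩, hxt⟩, -⟩ := hb
    have := (isForest_ext C k).covBy_unique hxs hxt
    cases this
    rcases isForest_ext C (k + 1) _ a b hs ht with h | h
    · rcases h.eq_or_lt with h | h <;> simp [h]
    · rcases h.eq_or_lt with h | h <;> simp [h]

end ThicketComplex

/-! ### The `ι`-epimorphism of a morphism of thicket complexes -/

theorem HypergraphData.gammaTo_of_lt (H : HypergraphData.{u}) {j i : ℕ} (p : H.S (i + 1))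
    (h : j < i) : H.gammaTo (j + 1) ⟨i + 1, p⟩ = H.gammaTo (j + 1) ⟨i, H.γ i p⟩ := by
  rw [HypergraphData.gammaTo, if_pos (Nat.succ_le_of_lt h)]

namespace ThicketComplex

variable {S T U : ThicketComplex.{u}} (f : S ⟶ T) {i : ℕ}

/-- The map on extensions induced by a morphism. -/
def ext (x : S.Ext i) : T.Ext i := extMap (Hom.toFun f) i x

@[simp] theorem ext_le_ext {x y : S.Ext i} : ext f x ≤ ext f y ↔ x ≤ y := Hom.ext_le_iff f i x y

/-- The faces of the source whose images lie below `t`. -/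
def under (t : T.Ext i) : Set (S.Ext i) := {s | ext f s ≤ t}

variable {f}

theorem mem_under {t : T.Ext i} {s : S.Ext i} : s ∈ under f t ↔ ext f s ≤ t := Iff.rfl

theorem under_mono {t t' : T.Ext i} (h : t ≤ t') : under f t ⊆ under f t' :=
  fun _ hs => le_trans hs h

/-- The images have a supremum since the target is a forest; `sup_defined` brings it back and
`map_sup` keeps its image below w. Both halves of sup-preservation enter the construction of `pull`
here. -/
theorem exists_isLUB_of_ext_le {x y : S.Ext i} {w : T.Ext i} (hx : ext f x ≤ w)
    (hy : ext f y ≤ w) : ∃ z, IsLUB {x, y} z ∧ ext f z ≤ w := by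
  obtain ⟨z, hz⟩ := Hom.sup_defined f i x y ((isForest_ext T i).exists_isLUB hx hy)
  refine ⟨z, hz, (Hom.map_sup f i x y z hz).2 ?_⟩
  rintro _ (rfl | rfl) <;> assumption

theorem exists_isGreatest_of_directed {X : Set (S.Ext i)} (hX : X.Nonempty)
    (h : ∀ x ∈ X, ∀ y ∈ X, ∃ z ∈ X, x ≤ z ∧ y ≤ z) : ∃ m, IsGreatest X m := by
  obtain ⟨m, hm⟩ := X.toFinite.exists_maximal hX
  refine ⟨m, hm.1, fun x hx => ?_⟩
  obtain ⟨z, hz, hmz, hxz⟩ := h m hm.1 x hx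
  exact hxz.trans (hm.2 hz hmz)

theorem exists_isGreatest_under {t : T.Ext i} (h : (under f t).Nonempty) :
    ∃ m, IsGreatest (under f t) m := by
  refine exists_isGreatest_of_directed h fun x hx y hy => ?_
  obtain ⟨z, hz, hzt⟩ := exists_isLUB_of_ext_le (mem_under.1 hx) hy
  exact ⟨z, hzt, hz.1 (by simp), hz.1 (by simp)⟩

theorem dot_zero_le (s : T.T 0) (t : T.Ext 0) : .dot s ≤ t := by
  obtain ⟨z, hz⟩ := T.isThicketComplex.singleton_zero
  obtain ⟨r, hr⟩ := exists_dot_le t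
  rwa [hz s, ← hz r]

theorem under_zero_nonempty (t : T.Ext 0) : (under f t).Nonempty :=
  ⟨.dot S.isThicketComplex.singleton_zero.choose, dot_zero_le _ t⟩

variable (f) in
open Classical in
/-- The map on faces assigned to a morphism: the greatest face below, if there is one, and
otherwise the value at the codomain. -/
noncomputable def pull : ∀ i, T.Ext i → S.star.Face
  | 0, t => ⟨0, (exists_isGreatest_under (under_zero_nonempty (f := f) t)).choose⟩
  | k + 1, t =>
    if h : (under f t).Nonempty then ⟨k + 1, (exists_isGreatest_under h).choose⟩
    else pull k (T.cod t)

theorem pull_of_isGreatest {t : T.Ext i} {m : S.Ext i} (h : IsGreatest (under f t) m) :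
    pull f i t = ⟨i, m⟩ := by
  cases i with
  | zero =>
    rw [pull]
    exact congrArg _ ((exists_isGreatest_under (under_zero_nonempty t)).choose_spec.unique h)
  | succ k =>
    have hne : (under f t).Nonempty := ⟨m, h.1⟩
    rw [pull, dif_pos hne]
    exact congrArg _ ((exists_isGreatest_under hne).choose_spec.unique h)

theorem pull_of_empty {t : T.Ext (i + 1)} (h : ¬ (under f t).Nonempty) :
    pull f (i + 1) t = pull f i (T.cod t) := by
  rw [pull, dif_neg h]

theorem pull_dim_le (t : T.Ext i) : (pull f i t).1 ≤ i := by
  induction i with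
  | zero => rfl
  | succ k ih =>
    by_cases h : (under f t).Nonempty
    · obtain ⟨m, hm⟩ := exists_isGreatest_under h
      rw [pull_of_isGreatest hm]
    · rw [pull_of_empty h]
      exact (ih _).trans k.le_succ

theorem under_nonempty_iff {t : T.Ext i} : (under f t).Nonempty ↔ (pull f i t).1 = i := by
  constructor
  · intro h
    obtain ⟨m, hm⟩ := exists_isGreatest_under h
    rw [pull_of_isGreatest hm]
  · intro h
    cases i with
    | zero => exact under_zero_nonempty t
    | succ k =>
      by_contra hn
      rw [pull_of_empty hn] at h
      have := pull_dim_le (f := f) (T.cod t)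
      omega

theorem pull_eq_iff {t : T.Ext i} {m : S.Ext i} :
    pull f i t = ⟨i, m⟩ ↔ IsGreatest (under f t) m := by
  refine ⟨fun h => ?_, pull_of_isGreatest⟩
  have hdim : (pull f i t).1 = i := by rw [h]
  obtain ⟨m', hm'⟩ := exists_isGreatest_under 
    (under_nonempty_iff.2 hdim)
  rw [pull_of_isGreatest hm'] at h
  cases h
  exact hm'

theorem ext_circ_mem_leavesCirc {q : T.Ext (i + 1)} {s : S.T (i + 1)} :
    ext f (.circ s : S.Ext i) ∈ T.leavesCirc q ↔ (.dot s : S.Ext (i + 1)) ∈ under f q :=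
  circ_mem_leavesCirc

theorem ext_mem_leavesCirc {q : T.Ext (i + 1)} {p : S.Ext (i + 1)} (hp : IsGreatest (under f q) p)
    {s : S.Ext i} : ext f s ∈ T.leavesCirc q ↔ s ∈ S.leavesCirc p := by
  cases s with
  | circ s =>
    rw [ext_circ_mem_leavesCirc, circ_mem_leavesCirc]
    exact ⟨fun h => hp.2 h, fun h => ((ext_le_ext f).2 h).trans hp.1⟩
  | dot s => exact iff_of_false dot_notMem_leavesCirc dot_notMem_leavesCirc

theorem ext_notMem_leavesCirc {q : T.Ext (i + 1)} (h : ¬ (under f q).Nonempty) (s : S.Ext i) :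
    ext f s ∉ T.leavesCirc q := by
  cases s with
  | circ s => exact fun hs => h ⟨_, ext_circ_mem_leavesCirc.1 hs⟩
  | dot s => exact dot_notMem_leavesCirc

/-- Join any s below `cod q` with `cod p`. The image of the join lies between a member of
`leavesCirc q` and its top, so by convexity the join belongs to `leavesCirc p` and is at most `cod
p`. -/
theorem isGreatest_under_cod {q : T.Ext (i + 1)} {p : S.Ext (i + 1)}
    (hp : IsGreatest (under f q) p) : IsGreatest (under f (T.cod q)) (S.cod p) := by
  have hmem := (ext_mem_leavesCirc hp).2 (cod_isGreatest p).1
  have hle := (cod_isGreatest q).2 hmem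
  refine ⟨hle, fun s hs => ?_⟩
  obtain ⟨z, hz, hzq⟩ := exists_isLUB_of_ext_le (mem_under.1 hs) hle
  have hcz : S.cod p ≤ z := hz.1 (by simp)
  have hzL := (isConvexSubtree_leavesCirc q).mem_of_le hmem (cod_isGreatest q).1
    ((ext_le_ext f).2 hcz) hzq
  exact (hz.1 (by simp)).trans ((cod_isGreatest p).2 ((ext_mem_leavesCirc hp).1 hzL))

theorem mem_bd_of_isGreatest {q : T.Ext (i + 1)} {p : S.Ext (i + 1)}
    (hp : IsGreatest (under f q) p) {x : T.Ext i} (hx : x ∈ T.bd q) {w : S.Ext i}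
    (hw : IsGreatest (under f x) w) : w ∈ S.bd p := by
  have hxlt := lt_cod_of_mem_bd hx
  have hwp : w ≤ S.cod p := (isGreatest_under_cod hp).2 (hw.1.trans hxlt.le)
  obtain ⟨⟨l, hl, hxl⟩, hxL⟩ := hx
  have hwL : w ∉ S.leavesCirc p := fun h =>
    hxL ((isConvexSubtree_leavesCirc q).mem_of_le ((ext_mem_leavesCirc hp).2 h) hl hw.1 hxl.1.le)
  have hlt : w < S.cod p := lt_of_le_of_ne hwp fun h => hwL (h ▸ (cod_isGreatest p).1)
  obtain ⟨y, hy, hyp⟩ := exists_covBy_le hlt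
  -- The parent y of w on the way to `cod p` cannot map below x, by maximality of w. So it maps
  -- above the parent l of x, and convexity places its image in `leavesCirc q`.
  have hyx : x < ext f y := by
    rcases isForest_ext T i _ x (ext f y) hw.1 ((ext_le_ext f).2 hy.1.le) with h | h
    · refine lt_of_le_of_ne h ?_
      rintro rfl
      exact hy.1.not_ge (hw.2 (mem_under.2 le_rfl))
    · exact (hy.1.not_ge (hw.2 h)).elim
  refine ⟨⟨y, (ext_mem_leavesCirc hp).1 ?_, hy⟩, hwL⟩
  exact (isConvexSubtree_leavesCirc q).mem_of_le hl (cod_isGreatest q).1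
    ((isForest_ext T i).le_of_covBy hxl hyx)
    (((ext_le_ext f).2 hyp).trans (isGreatest_under_cod hp).1)

/-- The image of w falls below some x in `bd q`. The greatest face under x is again in `bd p` and
lies above w, so it equals w. -/
theorem exists_isGreatest_of_mem_bd {q : T.Ext (i + 1)} {p : S.Ext (i + 1)}
    (hp : IsGreatest (under f q) p) {w : S.Ext i} (hw : w ∈ S.bd p) :
    ∃ x ∈ T.bd q, IsGreatest (under f x) w := by
  have hle : ext f w ≤ T.cod q :=
    ((ext_le_ext f).2 (lt_cod_of_mem_bd hw).le).trans (isGreatest_under_cod hp).1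
  obtain ⟨x, hx, hwx⟩ := exists_mem_bd_of_le hle (fun h => hw.2 ((ext_mem_leavesCirc hp).1 h))
  obtain ⟨m, hm⟩ := exists_isGreatest_under (f := f) ⟨w, hwx⟩
  have hmw : w ≤ m := hm.2 hwx
  obtain rfl := bd_unique hw (mem_bd_of_isGreatest hp hx hm) le_rfl hmw
  exact ⟨x, hx, hm⟩

theorem eq_of_under_nonempty {q : T.Ext (i + 1)} {w : S.Ext i} {x y : T.Ext i} (hx : x ∈ T.bd q)
    (hy : y ∈ T.bd q) (hwx : w ∈ under f x) (hwy : w ∈ under f y) : x = y :=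
  bd_unique hx hy hwx hwy

variable (f) in
/-- `pull` on the total set of faces. -/
noncomputable def pullFace (t : T.star.Face) : S.star.Face := pull f t.1 t.2

theorem mem_ker_pullFace {x : T.Ext i} :
    (pullFace f ⟨i, x⟩).1 < i ↔ ¬ (under f x).Nonempty := by
  rw [under_nonempty_iff]
  have := pull_dim_le (f := f) x
  change (pull f i x).1 < i ↔ _
  omega

variable (f) in
/-- The `ι`-epimorphism assigned to a morphism of thicket complexes. -/
noncomputable def pullHom :
    ((⟨T.star, star_isPositiveOpetopicCardinal T⟩ : PositiveOpetopicCardinal.{u}) ⟶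
      ⟨S.star, star_isPositiveOpetopicCardinal S⟩) :=
  PositiveOpetopicCardinal.IotaEpi.mk
    (P := ⟨T.star, star_isPositiveOpetopicCardinal T⟩)
    (Q := ⟨S.star, star_isPositiveOpetopicCardinal S⟩)
    (pullFace f)
    (fun t => pull_dim_le _)
    (by
      intro k (q : T.Ext (k + 1))
      change pull f k (T.cod q) = S.star.gammaTo k (pull f (k + 1) q)
      by_cases h : (under f q).Nonempty
      · obtain ⟨p, hp⟩ := exists_isGreatest_under h
        rw [pull_of_isGreatest hp, pull_of_isGreatest (isGreatest_under_cod hp)]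
        exact (PositiveOpetopicCardinal.gammaTo_succ S.star k p).symm
      · rw [pull_of_empty h,
          PositiveOpetopicCardinal.gammaTo_of_le _ _ _ (pull_dim_le _)])
    (by
      intro k (q : T.Ext (k + 1)) (p : S.Ext (k + 1)) h
      have hp : IsGreatest (under f q) p := pull_eq_iff.1 h
      refine ⟨?_, ?_, ?_⟩
      · rintro _ ⟨⟨x, hx, rfl⟩, hk⟩
        obtain ⟨w, hw⟩ := exists_isGreatest_under (not_not.1 (mt mem_ker_pullFace.2 hk))
        exact ⟨w, mem_bd_of_isGreatest hp hx hw, (pull_of_isGreatest hw).symm⟩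
      · rintro _ ⟨⟨x, hx, rfl⟩, hk⟩ _ ⟨⟨y, hy, rfl⟩, hl⟩ hxy
        obtain ⟨w, hw⟩ := exists_isGreatest_under (not_not.1 (mt mem_ker_pullFace.2 hk))
        have hw' : IsGreatest (under f y) w :=
          pull_eq_iff.1 ((Eq.symm hxy).trans (pull_of_isGreatest hw))
        rw [eq_of_under_nonempty hx hy hw.1 hw'.1]
      · rintro _ ⟨w, hw, rfl⟩
        obtain ⟨x, hx, hxw⟩ := exists_isGreatest_of_mem_bd hp hw
        exact ⟨⟨k, x⟩, ⟨⟨x, hx, rfl⟩, fun h => mem_ker_pullFace.1 h ⟨w, hxw.1⟩⟩,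
          pull_of_isGreatest hxw⟩)
    (by
      intro k (q : T.Ext (k + 1)) (p : S.Ext k) h
      have hq : ¬ (under f q).Nonempty := by
        rw [under_nonempty_iff]
        have := congrArg Sigma.fst h
        change (pull f (k + 1) q).1 = k at this
        omega
      have hp : IsGreatest (under f (T.cod q)) p := pull_eq_iff.1 ((pull_of_empty hq).symm.trans h)
      -- Nothing lies under q, so no image is in `leavesCirc q` and p falls under one x in `bd q`.
      -- Whatever lies under another element of `bd q` is at most p, hence also under x; so x is the
      -- only one outside the kernel.
      obtain ⟨x, hx, hpx⟩ := exists_mem_bd_of_le hp.1 (ext_notMem_leavesCirc hq p)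
      have hle : ∀ y ∈ T.bd q, ∀ w ∈ under f y, w ≤ p := fun y hy w hw =>
        hp.2 (under_mono (lt_cod_of_mem_bd hy).le hw)
      have hxp : IsGreatest (under f x) p := ⟨hpx, hle x hx⟩
      have huniq : ∀ y ∈ T.bd q, (under f y).Nonempty → y = x := fun y hy ⟨w, hw⟩ =>
        eq_of_under_nonempty hy hx hw (((ext_le_ext f).2 (hle y hy w hw)).trans hpx)
      have hset : (Sigma.mk k '' T.bd q) \ PositiveOpetopicCardinal.ker
          (P := ⟨T.star, star_isPositiveOpetopicCardinal T⟩)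
          (Q := ⟨S.star, star_isPositiveOpetopicCardinal S⟩) (pullFace f) =
          {(⟨k, x⟩ : T.star.Face)} := by
        refine Set.eq_singleton_iff_unique_mem.2
          ⟨⟨⟨x, hx, rfl⟩, fun h => mem_ker_pullFace.1 h ⟨p, hpx⟩⟩, ?_⟩
        rintro _ ⟨⟨y, hy, rfl⟩, hk⟩
        rw [huniq y hy (not_not.1 (mt mem_ker_pullFace.2 hk))]
        rfl
      refine (congrArg (fun A => Set.BijOn (pullFace f) A {⟨k, p⟩}) hset).mpr ?_
      exact Set.bijOn_singleton.2 (pull_of_isGreatest hxp))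
    (by
      rintro k (q : T.Ext (k + 1)) h _ ⟨(x : T.Ext k), hx, rfl⟩
      change (pull f (k + 1) q).1 < k at h
      have hq : ¬ (under f q).Nonempty := by
        rw [under_nonempty_iff]
        omega
      rw [pull_of_empty hq] at h
      refine mem_ker_pullFace.2 fun ⟨w, hw⟩ => ?_
      have : (under f (T.cod q)).Nonempty := ⟨w, under_mono (lt_cod_of_mem_bd hx).le hw⟩
      rw [under_nonempty_iff] at this
      omega)
    (by
      rintro ⟨k, (s : S.Ext k)⟩
      exact ⟨⟨k, ext f s⟩, pull_of_isGreatest ⟨mem_under.2 le_rfl, fun _ h => (ext_le_ext f).1 h⟩⟩)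

/-! #### The description of the assigned map by domains of iterated codomains -/

theorem domTo_self (t : T.Ext i) : T.domTo i ⟨i, t⟩ = {t} := by
  ext x
  constructor
  · rintro (h | ⟨r, h, -⟩)
    · cases h; rfl
    · rw [PositiveOpetopicCardinal.gammaTo_of_le _ _ _ (Nat.le_succ i)] at h
      have := congrArg Sigma.fst h
      simp at this
  · rintro rfl
    exact Or.inl rfl

theorem domTo_succ (t : T.Ext (i + 1)) : T.domTo i ⟨i + 1, t⟩ = T.bd t := by
  ext x
  constructor
  · rintro (h | ⟨r, h, hx⟩)
    · have := congrArg Sigma.fst h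
      simp at this
    · have h := (PositiveOpetopicCardinal.gammaTo_of_le T.star (i + 1) ⟨i + 1, t⟩ le_rfl).symm.trans h
      cases h
      exact hx
  · exact fun hx => Or.inr ⟨t, PositiveOpetopicCardinal.gammaTo_of_le _ _ _ le_rfl, hx⟩

theorem domTo_cod {j : ℕ} (hj : j < i) (t : T.Ext (i + 1)) :
    T.domTo j ⟨i + 1, t⟩ = T.domTo j ⟨i, T.cod t⟩ := by
  have h : T.star.gammaTo (j + 1) ⟨i + 1, t⟩ = T.star.gammaTo (j + 1) ⟨i, T.cod t⟩ := 
    T.star.gammaTo_of_lt t hj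
  ext x
  change (_ ∨ ∃ r, T.star.gammaTo (j + 1) ⟨i + 1, t⟩ = _ ∧ _) ↔ (_ ∨ _)
  rw [h]
  refine or_congr_left (iff_of_false ?_ ?_)
  · intro h
    have := congrArg Sigma.fst h
    simp only at this
    omega
  · intro h
    have := congrArg Sigma.fst h
    simp only at this
    omega

theorem below_self (t : T.Ext i) : below f ⟨i, t⟩ i = under f t := by
  ext s
  change (∃ x ∈ T.domTo i ⟨i, t⟩, ext f s ≤ x) ↔ _
  rw [domTo_self]
  simp [mem_under]

/-- Images avoid `leavesCirc t`, so being below `cod t` is the same as being below some element of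
`bd t`. This reconciles the recursion of `pull` with the description by domains. -/
theorem below_succ {t : T.Ext (i + 1)} (h : ¬ (under f t).Nonempty) :
    below f ⟨i + 1, t⟩ i = under f (T.cod t) := by
  ext s
  change (∃ x ∈ T.domTo i ⟨i + 1, t⟩, ext f s ≤ x) ↔ _
  rw [domTo_succ]
  constructor
  · rintro ⟨x, hx, hs⟩
    exact le_trans hs (lt_cod_of_mem_bd hx).le
  · exact fun hs => exists_mem_bd_of_le hs (ext_notMem_leavesCirc h s)

theorem below_cod {t : T.Ext (i + 1)} (h : ¬ (under f t).Nonempty) {j : ℕ} (hj : j ≤ i) :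
    below f ⟨i + 1, t⟩ j = below f ⟨i, T.cod t⟩ j := by
  rcases hj.eq_or_lt with rfl | hj
  · rw [below_succ h, below_self]
  · simp only [below, domTo_cod hj]

theorem pull_spec (t : T.Ext i) :
    IsGreatest {j | j ≤ i ∧ (below f ⟨i, t⟩ j).Nonempty} (pull f i t).1 ∧
      IsGreatest (below f ⟨i, t⟩ (pull f i t).1) (pull f i t).2 := by
  have main : ∀ {i : ℕ} (t : T.Ext i), (under f t).Nonempty →
      IsGreatest {j | j ≤ i ∧ (below f ⟨i, t⟩ j).Nonempty} (pull f i t).1 ∧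
        IsGreatest (below f ⟨i, t⟩ (pull f i t).1) (pull f i t).2 := by
    intro i t h
    obtain ⟨m, hm⟩ := exists_isGreatest_under h
    rw [pull_of_isGreatest hm, below_self]
    refine ⟨⟨⟨le_rfl, ?_⟩, fun j hj => hj.1⟩, hm⟩
    rwa [below_self]
  induction i with
  | zero => exact main t (under_zero_nonempty t)
  | succ k ih =>
    by_cases h : (under f t).Nonempty
    · exact main t h
    · have hle := pull_dim_le (f := f) (T.cod t)
      rw [pull_of_empty h]
      obtain ⟨h1, h2⟩ := ih (T.cod t)
      refine ⟨⟨⟨hle.trans k.le_succ, ?_⟩, ?_⟩, ?_⟩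
      · rw [below_cod h hle]
        exact h1.1.2
      · rintro j ⟨hj, hne⟩
        have hjk : j ≤ k := by
          by_contra hn
          obtain rfl : j = k + 1 := by omega
          rw [below_self] at hne
          exact h hne
        exact h1.2 ⟨hjk, by rwa [below_cod h hjk] at hne⟩
      · rw [below_cod h hle]
        exact h2

theorem isStarMap_pullFace : IsStarMap f (pullFace f) := by
  rintro ⟨i, t⟩ j s
  obtain ⟨h1, h2⟩ := pull_spec (f := f) t
  constructor
  · intro h
    change pull f i t = _ at h
    rw [h] at h1 h2
    exact ⟨h1, h2⟩
  · rintro ⟨h3, h4⟩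
    change pull f i t = _
    have hj := h1.unique h3
    generalize pull f i t = y at *
    obtain ⟨l, y⟩ := y
    obtain rfl : l = j := hj
    exact congrArg (Sigma.mk l) (h2.unique h4)

/-! ### Functoriality of `pull` -/

theorem pull_id (t : T.Ext i) : pull (𝟙 T) i t = ⟨i, t⟩ := by
  have h : ∀ s : T.Ext i, ext (𝟙 T) s = s := fun s => extMap_id T i s
  refine pull_of_isGreatest ⟨(h t).le, fun s hs => ?_⟩
  rwa [mem_under, h] at hs

theorem ext_comp (f : S ⟶ T) (g : T ⟶ U) (s : S.Ext i) : ext (f ≫ g) s = ext g (ext f s) :=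
  extMap_comp (Hom.toFun f) (Hom.toFun g) i s

theorem under_comp (f : S ⟶ T) (g : T ⟶ U) {t : U.Ext i} {w : T.Ext i}
    (hw : IsGreatest (under g t) w) : under (f ≫ g) t = under f w := by
  ext s
  rw [mem_under, mem_under, ext_comp]
  exact ⟨fun h => hw.2 h, fun h => ((ext_le_ext g).2 h).trans hw.1⟩

theorem pull_comp (f : S ⟶ T) (g : T ⟶ U) (t : U.Ext i) :
    pull (f ≫ g) i t = pullFace f (pull g i t) := by
  have main : ∀ {i : ℕ} (t : U.Ext i), (under (f ≫ g) t).Nonempty →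
      pull (f ≫ g) i t = pullFace f (pull g i t) := by
    rintro i t ⟨s, hs⟩
    have hs' : ext f s ∈ under g t := by rwa [mem_under, ← ext_comp]
    obtain ⟨w, hw⟩ := exists_isGreatest_under ⟨_, hs'⟩
    rw [pull_of_isGreatest hw]
    change _ = pull f i w
    obtain ⟨m, hm⟩ := exists_isGreatest_under (f := f) (t := w) ⟨s, hw.2 hs'⟩
    rw [pull_of_isGreatest hm]
    refine pull_of_isGreatest ?_
    rwa [under_comp f g hw]
  induction i with
  | zero => exact main t (under_zero_nonempty t)
  | succ k ih =>
    by_cases h : (under (f ≫ g) t).Nonempty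
    · exact main t h
    rw [pull_of_empty h, ih]
    by_cases hg : (under g t).Nonempty
    · obtain ⟨w, hw⟩ := exists_isGreatest_under hg
      rw [under_comp f g hw] at h
      rw [pull_of_isGreatest hw, pull_of_isGreatest (isGreatest_under_cod hw)]
      exact (pull_of_empty h).symm
    · rw [pull_of_empty hg]

end ThicketComplex

/-! ### The structure of positive opetopic cardinals -/

namespace PositiveOpetopicCardinal

section Structure

variable (P : PositiveOpetopicCardinal.{u})

/-- The order `≤⁺`. -/
@[reducible] def upperOrder (k : ℕ) : PartialOrder (P.S k) where
  le a b := a = b ∨ P.upperLt k a b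
  lt a b := P.upperLt k a b
  le_refl a := Or.inl rfl
  le_trans a b c := by
    rintro (rfl | h) (rfl | h')
    · exact Or.inl rfl
    · exact Or.inr h'
    · exact Or.inr h
    · exact Or.inr (Relation.TransGen.trans h h')
  lt_iff_le_not_ge a b := by
    have hs := (P.isPositiveOpetopicCardinal.strictness k).irrefl
    constructor
    · refine fun h => ⟨Or.inr h, ?_⟩
      rintro (rfl | h')
      · exact hs _ h
      · exact hs _ (Relation.TransGen.trans h h')
    · rintro ⟨rfl | h, h'⟩
      · exact (h' (Or.inl rfl)).elim
      · exact h
  le_antisymm a b := by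
    have hs := (P.isPositiveOpetopicCardinal.strictness k).irrefl
    rintro (rfl | h) (h' | h')
    · rfl
    · rfl
    · exact h'.symm
    · exact (hs _ (Relation.TransGen.trans h h')).elim

attribute [local instance] upperOrder

instance finite_S (k : ℕ) : Finite (P.S k) := P.isPositiveOpetopicCardinal.finite k

variable {P} {k : ℕ}

theorem lt_γ_of_mem_δ {a : P.S k} {α : P.S (k + 1)} (h : a ∈ P.δ k α) : a < P.γ k α :=
  Relation.TransGen.single ⟨α, h, rfl⟩

/-- Faces that are not codomains. -/
def NotCod (s : P.S k) : Prop := ∀ q, P.γ k q ≠ s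

theorem exists_γ_eq_of_lt {a b : P.S k} (h : a < b) : ∃ α, P.γ k α = b := by
  obtain ⟨_, -, α, -, h⟩ := Relation.TransGen.tail'_iff.1 h
  exact ⟨α, h⟩

theorem NotCod.not_lt {a b : P.S k} (h : NotCod b) : ¬ a < b := by
  intro hab
  obtain ⟨α, hα⟩ := exists_γ_eq_of_lt hab
  exact h α hα

theorem NotCod.eq_of_le {a b : P.S k} (h : NotCod b) (hab : a ≤ b) : a = b :=
  hab.eq_or_lt.resolve_right h.not_lt

/-- Pencil linearity makes s and t equal or comparable by `<⁺`, and nothing is `<⁺`-below a face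
that is not a codomain. -/
theorem NotCod.γ_injective {s t : P.S (k + 1)} (hs : NotCod s) (ht : NotCod t)
    (h : P.γ k s = P.γ k t) : s = t := by
  rcases P.isPositiveOpetopicCardinal.pencil_γ k (P.γ k s) s t rfl h with h | h | h
  · exact (ht.not_lt h).elim
  · exact h
  · exact (hs.not_lt h).elim

theorem NotCod.δ_injective {s t : P.S (k + 1)} (hs : NotCod s) (ht : NotCod t) {x : P.S k}
    (h : x ∈ P.δ k s) (h' : x ∈ P.δ k t) : s = t := by
  rcases P.isPositiveOpetopicCardinal.pencil_δ k x s t h h' with h | h | h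
  · exact (ht.not_lt h).elim
  · exact h
  · exact (hs.not_lt h).elim

theorem exists_notCod_le (a : P.S k) : ∃ s, NotCod s ∧ s ≤ a := by
  obtain ⟨m, hm⟩ := (Set.toFinite {y | y ≤ a}).exists_minimal ⟨a, le_refl a⟩
  refine ⟨m, fun q hq => ?_, hm.1⟩
  obtain ⟨c, hc⟩ := P.isPositiveOpetopicCardinal.δ_total k q
  have hcm : c < m := hq ▸ lt_γ_of_mem_δ hc
  exact hcm.not_ge (hm.2 (hcm.le.trans hm.1) hcm.le)

theorem mem_γγ {a : P.S (k + 2)} {x : P.S k} : x = P.γ k (P.γ (k + 1) a) ↔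
    (∃ b ∈ P.δ (k + 1) a, P.γ k b = x) ∧ ∀ b ∈ P.δ (k + 1) a, x ∉ P.δ k b := by
  have := Set.ext_iff.1 (P.isPositiveOpetopicCardinal.globularity_γ k a) x
  simpa using this

theorem mem_δγ {a : P.S (k + 2)} {x : P.S k} : x ∈ P.δ k (P.γ (k + 1) a) ↔
    (∃ b ∈ P.δ (k + 1) a, x ∈ P.δ k b) ∧ ∀ b ∈ P.δ (k + 1) a, P.γ k b ≠ x := by
  have := Set.ext_iff.1 (P.isPositiveOpetopicCardinal.globularity_δ k a) x
  simpa using this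

/-- If α is the codomain of β, globularity finds a face in the domain of β with the same codomain as
α, and this face is strictly smaller. The resulting s is the root block of the pasting α. -/
theorem exists_notCod_γ_eq (α : P.S (k + 1)) : ∃ s, NotCod s ∧ s ≤ α ∧ P.γ k s = P.γ k α := by
  induction α using (wellFounded_lt (α := P.S (k + 1))).induction with
  | _ α ih =>
    by_cases h : NotCod α
    · exact ⟨α, h, le_rfl, rfl⟩
    · obtain ⟨β, rfl⟩ : ∃ β, P.γ (k + 1) β = α := by simpa [NotCod] using h
      obtain ⟨⟨b, hb, hbγ⟩, -⟩ := mem_γγ.1 (rfl : P.γ k (P.γ (k + 1) β) = _)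
      obtain ⟨s, hs, hsb, hsγ⟩ := ih b (lt_γ_of_mem_δ hb)
      exact ⟨s, hs, hsb.trans (lt_γ_of_mem_δ hb).le, hsγ.trans hbγ⟩

variable (P k) in
/-- Every face of dimension `k + 1` is the pasting of the faces below it that are not codomains. -/
def HasNormalForms : Prop :=
  ∀ a : P.S (k + 1),
    (∀ x, x = P.γ k a ↔ (∃ s, NotCod s ∧ s ≤ a ∧ P.γ k s = x) ∧
      ∀ s, NotCod s → s ≤ a → x ∉ P.δ k s) ∧
    (∀ x, x ∈ P.δ k a ↔ (∃ s, NotCod s ∧ s ≤ a ∧ x ∈ P.δ k s) ∧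
      ∀ s, NotCod s → s ≤ a → P.γ k s ≠ x)

/-- Climb from γ s: either it is in the domain of no block below a and equals γ a, or it is in the
domain of such a block t and γ t is strictly higher. -/
theorem HasNormalForms.γ_le (h : P.HasNormalForms k) {s a : P.S (k + 1)} (hs : NotCod s)
    (hsa : s ≤ a) : P.γ k s ≤ P.γ k a := by
  have main : ∀ x s, P.γ k s = x → NotCod s → s ≤ a → x ≤ P.γ k a := by
    intro x
    induction x using (wellFounded_gt (α := P.S k)).induction with
    | _ x ih =>
      rintro s rfl hs hsa
      by_cases hx : ∀ t, NotCod t → t ≤ a → P.γ k s ∉ P.δ k t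
      · exact (((h a).1 _).2 ⟨⟨s, hs, hsa, rfl⟩, hx⟩).le
      · push Not at hx
        obtain ⟨t, ht, hta, hst⟩ := hx
        exact (lt_γ_of_mem_δ hst).le.trans (ih _ (lt_γ_of_mem_δ hst) t rfl ht hta)
  exact main _ s rfl hs hsa

theorem HasNormalForms.exists_of_lt (h : P.HasNormalForms k) {a b : P.S k} (hab : a < b) :
    ∃ s, NotCod s ∧ a ∈ P.δ k s ∧ P.γ k s ≤ b := by
  obtain ⟨c, ⟨α, hα, rfl⟩, hcb⟩ := Relation.TransGen.head'_iff.1 hab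
  obtain ⟨⟨s, hs, hsα, has⟩, -⟩ := ((h α).2 a).1 hα
  refine ⟨s, hs, has, (h.γ_le hs hsα).trans ?_⟩
  rcases Relation.reflTransGen_iff_eq_or_transGen.1 hcb with h | h
  · exact h.symm.le
  · exact Or.inr h

/-- By `exists_of_lt`, each element strictly above x is above γ s for a block s with x in δ s.
Pencil linearity makes s unique, so the comparison moves up to γ s. -/
theorem HasNormalForms.isForest (h : P.HasNormalForms k) : IsForest (P.S k) := by
  intro x
  induction x using (wellFounded_gt (α := P.S k)).induction with
  | _ x ih =>
    intro a b ha hb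
    rcases ha.eq_or_lt with rfl | ha
    · exact Or.inl hb
    rcases hb.eq_or_lt with rfl | hb
    · exact Or.inr ha.le
    obtain ⟨s, hs, hxs, hsa⟩ := h.exists_of_lt ha
    obtain ⟨t, ht, hxt, htb⟩ := h.exists_of_lt hb
    obtain rfl := hs.δ_injective ht hxs hxt
    exact ih _ (lt_γ_of_mem_δ hxs) a b hsa htb

theorem HasNormalForms.covBy (h : P.HasNormalForms k) {s : P.S (k + 1)} (hs : NotCod s) {x : P.S k}
    (hx : x ∈ P.δ k s) : x ⋖ P.γ k s := by
  refine ⟨lt_γ_of_mem_δ hx, fun z hz hz' => ?_⟩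
  obtain ⟨t, ht, hxt, htz⟩ := h.exists_of_lt hz
  obtain rfl := hs.δ_injective ht hx hxt
  exact hz'.not_ge htz

theorem HasNormalForms.mem_δ_of_covBy (h : P.HasNormalForms k) {s : P.S (k + 1)} (hs : NotCod s)
    {x : P.S k} (hx : x ⋖ P.γ k s) : x ∈ P.δ k s := by
  obtain ⟨t, ht, hxt, hts⟩ := h.exists_of_lt hx.1
  have := (lt_γ_of_mem_δ hxt)
  rcases hts.eq_or_lt with h1 | h1
  · rwa [← ht.γ_injective hs h1]
  · exact (hx.2 this h1).elim

theorem HasNormalForms.exists_of_lt_γ (h : P.HasNormalForms k) {s : P.S (k + 1)} (hs : NotCod s)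
    {x : P.S k} (hx : x < P.γ k s) : ∃ c ∈ P.δ k s, x ≤ c := by
  obtain ⟨c, hc⟩ := (Set.toFinite {y | x ≤ y ∧ y < P.γ k s}).exists_maximal ⟨x, le_rfl, hx⟩
  refine ⟨c, h.mem_δ_of_covBy hs ⟨hc.1.2, fun d hd hd' => ?_⟩, hc.1.1⟩
  exact hd.not_ge (hc.2 ⟨hc.1.1.trans hd.le, hd'⟩ hd.le)

theorem HasNormalForms.δ_unique (h : P.HasNormalForms k) {α : P.S (k + 1)} (hα : NotCod α)
    {x b c : P.S k} (hb : b ∈ P.δ k α) (hc : c ∈ P.δ k α) (hxb : x ≤ b) (hxc : x ≤ c) :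
    b = c := by
  have key : ∀ {b c : P.S k}, b ∈ P.δ k α → c ∈ P.δ k α → ¬ b < c := fun hb hc hlt =>
    (lt_γ_of_mem_δ hc).not_ge (h.isForest.le_of_covBy (h.covBy hα hb) hlt)
  rcases h.isForest x b c hxb hxc with h1 | h1
  · exact h1.eq_or_lt.resolve_right (key hb hc)
  · exact (h1.eq_or_lt.resolve_right (key hc hb)).symm

/-- A block is its own normal form. Otherwise a = γ α with α a block, and the forest order one
dimension up distributes the blocks below a among the b in δ α, each in exactly one. Globularity for
α then glues the normal forms of these b. -/
theorem HasNormalForms.descend (h : P.HasNormalForms (k + 1)) : P.HasNormalForms k := by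
  intro a
  induction a using (wellFounded_lt (α := P.S (k + 1))).induction with
  | _ a ih =>
    by_cases ha : NotCod a
    · have hle : ∀ s, NotCod s ∧ s ≤ a ↔ s = a := fun s =>
        ⟨fun hs => ha.eq_of_le hs.2, by rintro rfl; exact ⟨ha, le_rfl⟩⟩
      have hγ : P.γ k a ∉ P.δ k a := fun h => (lt_γ_of_mem_δ h).ne rfl
      constructor
      · intro x
        constructor
        · rintro rfl
          refine ⟨⟨a, ha, le_rfl, rfl⟩, fun s hs hsa => ?_⟩
          rwa [ha.eq_of_le hsa]
        · rintro ⟨⟨s, hs, hsa, rfl⟩, -⟩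
          rw [ha.eq_of_le hsa]
      · intro x
        constructor
        · intro hx
          refine ⟨⟨a, ha, le_rfl, hx⟩, fun s hs hsa => ?_⟩
          rw [ha.eq_of_le hsa]
          rintro rfl
          exact hγ hx
        · rintro ⟨⟨s, hs, hsa, hx⟩, -⟩
          rwa [← ha.eq_of_le hsa]
    · obtain ⟨α', hα'⟩ : ∃ α, P.γ (k + 1) α = a := by simpa [NotCod] using ha
      obtain ⟨α, hα, -, hγα⟩ := exists_notCod_γ_eq α'
      rw [hα'] at hγα
      subst hγα
      clear hα' α' ha
      have hL : ∀ s, NotCod s → s ≤ P.γ (k + 1) α → ∃ b ∈ P.δ (k + 1) α, s ≤ b := by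
        intro s hs hsa
        refine h.exists_of_lt_γ hα (lt_of_le_of_ne hsa ?_)
        rintro rfl
        exact hs α rfl
      have hup : ∀ b ∈ P.δ (k + 1) α, ∀ s, s ≤ b → s ≤ P.γ (k + 1) α := fun b hb s hs =>
        hs.trans (lt_γ_of_mem_δ hb).le
      have ih' : ∀ b ∈ P.δ (k + 1) α, _ := fun b hb => ih b (lt_γ_of_mem_δ hb)
      constructor
      · intro x
        rw [mem_γγ]
        constructor
        · rintro ⟨⟨b, hb, rfl⟩, hx⟩
          obtain ⟨⟨s, hs, hsb, hsx⟩, hb2⟩ := ((ih' b hb).1 _).1 rfl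
          refine ⟨⟨s, hs, hup b hb s hsb, hsx⟩, fun t ht hta htx => ?_⟩
          obtain ⟨c, hc, htc⟩ := hL t ht hta
          -- Globularity keeps γ b out of δ c, so inside c it must be cancelled by some block r with
          -- γ r = γ b. Then r = s, which forces b = c and contradicts the normal form of b.
          have : ¬ ∀ r, NotCod r → r ≤ c → P.γ k r ≠ P.γ k b := fun hr =>
            hx c hc (((ih' c hc).2 _).2 ⟨⟨t, ht, htc, htx⟩, hr⟩)
          push Not at this
          obtain ⟨r, hr, hrc, hrb⟩ := this
          obtain rfl := hr.γ_injective hs (hrb.trans hsx.symm)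
          obtain rfl := h.δ_unique hα hb hc hsb hrc
          exact hb2 t ht htc htx
        · rintro ⟨⟨s, hs, hsa, rfl⟩, hx⟩
          obtain ⟨b, hb, hsb⟩ := hL s hs hsa
          refine ⟨⟨b, hb, ?_⟩, fun c hc hcx => ?_⟩
          · exact (((ih' b hb).1 _).2 ⟨⟨s, hs, hsb, rfl⟩,
              fun t ht htb => hx t ht (hup b hb t htb)⟩).symm
          · obtain ⟨⟨t, ht, htc, htx⟩, -⟩ := ((ih' c hc).2 _).1 hcx
            exact hx t ht (hup c hc t htc) htx
      · intro x
        rw [mem_δγ]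
        constructor
        · rintro ⟨⟨b, hb, hxb⟩, hx⟩
          obtain ⟨⟨s, hs, hsb, hxs⟩, hb2⟩ := ((ih' b hb).2 _).1 hxb
          refine ⟨⟨s, hs, hup b hb s hsb, hxs⟩, fun t ht hta htx => ?_⟩
          obtain ⟨c, hc, htc⟩ := hL t ht hta
          have : ¬ ∀ r, NotCod r → r ≤ c → x ∉ P.δ k r := fun hr =>
            hx c hc (((ih' c hc).1 _).2 ⟨⟨t, ht, htc, htx⟩, hr⟩).symm
          push Not at this
          obtain ⟨r, hr, hrc, hxr⟩ := this
          obtain rfl := hr.δ_injective hs hxr hxs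
          obtain rfl := h.δ_unique hα hb hc hsb hrc
          exact hb2 t ht htc htx
        · rintro ⟨⟨s, hs, hsa, hxs⟩, hx⟩
          obtain ⟨b, hb, hsb⟩ := hL s hs hsa
          refine ⟨⟨b, hb, ?_⟩, fun c hc hcx => ?_⟩
          · exact ((ih' b hb).2 _).2 ⟨⟨s, hs, hsb, hxs⟩,
              fun t ht htb => hx t ht (hup b hb t htb)⟩
          · obtain ⟨⟨t, ht, htc, htx⟩, -⟩ := ((ih' c hc).1 _).1 hcx.symm
            exact hx t ht (hup c hc t htc) htx

theorem hasNormalForms (P : PositiveOpetopicCardinal.{u}) (k : ℕ) : P.HasNormalForms k := by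
  obtain ⟨N, hN⟩ := P.isPositiveOpetopicCardinal.finite_dim.bddAbove
  -- Descending induction on dimension: from N on there are no faces of dimension k + 1, so the
  -- claim is vacuous there.
  have main : ∀ d k, N ≤ k + d → P.HasNormalForms k := by
    intro d
    induction d with
    | zero =>
      intro k hk a
      have : k + 1 ≤ N := hN ⟨a⟩
      omega
    | succ d ih => exact fun k hk => (ih (k + 1) (by omega)).descend
  exact main N k (by omega)

theorem isForest_S (P : PositiveOpetopicCardinal.{u}) (k : ℕ) : IsForest (P.S k) :=
  (P.hasNormalForms k).isForest

/-! #### The thicket complex of a positive opetopic cardinal -/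

theorem lowerLt_γ {a b : P.S (k + 1)} (h : P.lowerLt (k + 1) a b) : P.γ k a < P.γ k b := by
  induction h with
  | single hb => exact lt_γ_of_mem_δ hb
  | tail _ hb ih => exact ih.trans (lt_γ_of_mem_δ hb)

/-- A climb from γ a to γ b passes through successive blocks, each having the previous codomain in
its domain; this is a lower chain. Its last block is b, since blocks are determined by codomains. -/
theorem lowerLt_iff {a b : P.S (k + 1)} (hb : NotCod b) :
    P.lowerLt (k + 1) a b ↔ P.γ k a < P.γ k b := by
  refine ⟨lowerLt_γ, ?_⟩
  have main : ∀ x a, P.γ k a = x → x < P.γ k b → P.lowerLt (k + 1) a b := by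
    intro x
    induction x using (wellFounded_gt (α := P.S k)).induction with
    | _ x ih =>
      rintro a rfl hab
      obtain ⟨s, hs, has, hsb⟩ := (P.hasNormalForms k).exists_of_lt hab
      rcases hsb.eq_or_lt with h | h
      · obtain rfl := hs.γ_injective hb h
        exact Relation.TransGen.single has
      · exact Relation.TransGen.head has (ih _ (lt_γ_of_mem_δ has) s rfl h)
  exact main _ a rfl

theorem StarFace.notCod (s : P.StarFace k) : NotCod s.1 := s.2

theorem StarFace.le_iff {s t : P.StarFace (k + 1)} : s ≤ t ↔ P.γ k s.1 ≤ P.γ k t.1 := by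
  change s = t ∨ P.lowerLt (k + 1) s.1 t.1 ↔ _
  rw [lowerLt_iff t.notCod, le_iff_eq_or_lt]
  refine or_congr_left ⟨fun h => h ▸ rfl, fun h => ?_⟩
  exact Subtype.ext (s.notCod.γ_injective t.notCod h)

theorem lt_of_notCod_zero {s t : P.S 0} (hs : NotCod s) (hst : s ≠ t) : s < t := by
  rcases P.isPositiveOpetopicCardinal.linear_zero s t with h | h | h
  · exact h
  · exact (hst h).elim
  · exact (hs.not_lt h).elim

theorem starFace_zero_eq (s t : P.StarFace 0) : s = t := by
  by_contra h
  exact t.notCod.not_lt (lt_of_notCod_zero s.notCod fun h' => h (Subtype.ext h'))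

instance finite_starFace (i : ℕ) : Finite (P.StarFace i) :=
  inferInstanceAs (Finite {p : P.S i // ∀ q, P.γ i q ≠ p})

theorem isForest_starFace (i : ℕ) : IsForest (P.StarFace i) := by
  intro x a b ha hb
  cases i with
  | zero => exact Or.inl (starFace_zero_eq a b).le
  | succ k =>
    rw [StarFace.le_iff] at ha hb
    simp only [StarFace.le_iff]
    exact P.isForest_S k _ _ _ ha hb

/-- This supplies convexity of the constellations. While γ s is strictly below γ t it is not γ a, so
the normal form of a has a block with γ s in its domain. That block is also the first one on the
climb to γ t, so the climb stays inside a. -/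
theorem le_of_γ_le {a s t : P.S (k + 1)} (hs : NotCod s) (ht : NotCod t) (hsa : s ≤ a)
    (hst : P.γ k s ≤ P.γ k t) (hta : P.γ k t ≤ P.γ k a) : t ≤ a := by
  have main : ∀ x s, P.γ k s = x → NotCod s → s ≤ a → x ≤ P.γ k t → t ≤ a := by
    intro x
    induction x using (wellFounded_gt (α := P.S k)).induction with
    | _ x ih =>
      rintro s rfl hs hsa hst
      rcases hst.eq_or_lt with h | h
      · rwa [← hs.γ_injective ht h]
      · obtain ⟨r, hr, hsr, hrt⟩ := (P.hasNormalForms k).exists_of_lt h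
        have : ¬ ∀ r, NotCod r → r ≤ a → P.γ k s ∉ P.δ k r := fun hn =>
          (h.trans_le hta).ne (((P.hasNormalForms k a).1 _).2 ⟨⟨s, hs, hsa, rfl⟩, hn⟩)
        push Not at this
        obtain ⟨r', hr', hra, hsr'⟩ := this
        obtain rfl := hr.δ_injective hr' hsr hsr'
        exact ih _ (lt_γ_of_mem_δ hsr) r rfl hr hra hrt
  exact main _ s rfl hs hsa hst

theorem NotCod.lt_γ_iff {s : P.S k} (hs : NotCod s) {t : P.S (k + 1)} :
    s < P.γ k t ↔ s ≤ P.γ k t :=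
  ⟨le_of_lt, fun h => lt_of_le_of_ne h fun h => hs t h.symm⟩

theorem star_isThicketComplex (P : PositiveOpetopicCardinal.{u}) : P.star.IsThicketComplex where
  thicket i := (isForest_starFace (P := P) i).isThicket
  convex i t := by
    have hτ : P.star.τ i t = {s : P.StarFace i | s.1 ≤ P.γ i t.1} := by
      ext s
      exact s.notCod.lt_γ_iff
    rw [hτ]
    cases i with
    | zero =>
      obtain ⟨s, hs, hst⟩ := exists_notCod_le (P.γ 0 t.1)
      refine ⟨⟨⟨s, hs⟩, hst, fun x _ => (starFace_zero_eq (P := P) _ _).le⟩, ?_⟩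
      intro x _ y _ r h _
      exact (h.ne (starFace_zero_eq (P := P) _ _)).elim
    | succ k =>
      -- The top of the constellation is the root block of the pasting γ t.
      obtain ⟨m, hm, hmt, hmγ⟩ := exists_notCod_γ_eq (P.γ (k + 1) t.1)
      refine ⟨⟨⟨m, hm⟩, hmt, fun x hx => ?_⟩, ?_⟩
      · refine StarFace.le_iff.2 ?_
        rw [hmγ]
        exact (P.hasNormalForms k).γ_le (StarFace.notCod x) hx
      · intro x hx y hy s hxs hsy
        exact le_of_γ_le (StarFace.notCod x) (StarFace.notCod s) hx (StarFace.le_iff.1 hxs.le)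
          ((StarFace.le_iff.1 hsy.le).trans ((P.hasNormalForms k).γ_le (StarFace.notCod y) hy))
  mono i t t' h s hs := lt_of_lt_of_le (α := P.S i) hs (StarFace.le_iff.1 h)
  comparable i t t' := by
    rintro ⟨s, hs, hs'⟩
    rcases P.isForest_S i s.1 _ _ (le_of_lt hs) (le_of_lt hs') with h | h
    · exact Or.inl (StarFace.le_iff.2 h)
    · exact Or.inr (StarFace.le_iff.2 h)
  finite_dim := P.isPositiveOpetopicCardinal.finite_dim.subset fun i ⟨s⟩ => ⟨s.1⟩
  singleton_zero := by
    obtain ⟨x⟩ := P.isPositiveOpetopicCardinal.nonempty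
    obtain ⟨s, hs, -⟩ := exists_notCod_le x
    exact ⟨⟨s, hs⟩, fun y => starFace_zero_eq y _⟩

/-! ### Recovering the faces of P from P^* -/

variable (P) in
/-- The thicket complex `P^*`. -/
def complex : ThicketComplex.{u} := ⟨P.star, P.star_isThicketComplex⟩

/-- The face of `P` given by an element of an extension in `P^*`. -/
def ofExt : P.complex.Ext k → P.S k
  | .circ s => P.γ k (Subtype.val (p := fun p => ∀ q, P.γ (k + 1) q ≠ p) s)
  | .dot s => Subtype.val (p := fun p => ∀ q, P.γ k q ≠ p) s

theorem ofExt_le {x y : P.complex.Ext k} : ofExt x ≤ ofExt y ↔ x ≤ y := by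
  cases x with
  | circ s =>
    cases y with
    | circ t => exact StarFace.le_iff.symm
    | dot t =>
      refine iff_of_false (fun h => ?_) ThicketComplex.not_circ_le_dot
      exact StarFace.notCod t _ ((StarFace.notCod t).eq_of_le h)
  | dot s =>
    cases y with
    | circ t => exact (StarFace.notCod s).lt_γ_iff.symm
    | dot t =>
      refine Iff.trans ⟨fun h => ?_, fun h => ?_⟩ ThicketComplex.dot_le_dot.symm
      · exact Subtype.ext ((StarFace.notCod t).eq_of_le h)
      · rw [h]

theorem ofExt_injective : Function.Injective (ofExt : P.complex.Ext k → P.S k) :=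
  fun _ _ h => le_antisymm (ofExt_le.1 h.le) (ofExt_le.1 h.ge)

theorem ofExt_surjective : Function.Surjective (ofExt : P.complex.Ext k → P.S k) := by
  intro a
  by_cases ha : NotCod a
  · exact ⟨.dot ⟨a, ha⟩, rfl⟩
  · obtain ⟨α, rfl⟩ : ∃ α, P.γ k α = a := by simpa [NotCod] using ha
    obtain ⟨s, hs, -, h⟩ := exists_notCod_γ_eq α
    exact ⟨.circ ⟨s, hs⟩, h⟩

variable (P k) in
/-- The extensions in `P^*` are the sets of faces of `P` with the order `≤⁺`. -/
noncomputable def extIso : P.complex.Ext k ≃o P.S k where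
  toEquiv := Equiv.ofBijective ofExt ⟨ofExt_injective, ofExt_surjective⟩
  map_rel_iff' := ofExt_le

theorem ofExt_image_leavesCirc (p : P.complex.Ext (k + 1)) :
    ofExt '' P.complex.leavesCirc p = {x | ∃ s, NotCod s ∧ s ≤ ofExt p ∧ P.γ k s = x} := by
  ext x
  constructor
  · rintro ⟨_, ⟨s, hs, rfl⟩, rfl⟩
    exact ⟨s.1, StarFace.notCod s, ofExt_le.2 hs, rfl⟩
  · rintro ⟨s, hs, hsp, rfl⟩
    exact ⟨.circ ⟨s, hs⟩, ThicketComplex.circ_mem_leavesCirc.2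
      ((ofExt_le (x := (.dot ⟨s, hs⟩ : P.complex.Ext (k + 1)))).1 hsp), rfl⟩

theorem ofExt_cod (p : P.complex.Ext (k + 1)) : ofExt (P.complex.cod p) = P.γ k (ofExt p) := by
  have h : IsGreatest (ofExt '' P.complex.leavesCirc p) (ofExt (P.complex.cod p)) := by
    obtain ⟨h1, h2⟩ := ThicketComplex.cod_isGreatest p
    refine ⟨⟨_, h1, rfl⟩, ?_⟩
    rintro _ ⟨x, hx, rfl⟩
    exact ofExt_le.2 (h2 hx)
  refine h.unique ?_
  rw [ofExt_image_leavesCirc]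
  refine ⟨?_, ?_⟩
  · obtain ⟨s, hs, h⟩ := exists_notCod_γ_eq (ofExt p)
    exact ⟨s, hs, h⟩
  · rintro _ ⟨s, hs, hsp, rfl⟩
    exact (P.hasNormalForms k).γ_le hs hsp

/-- For a block s, being covered by γ s means lying in δ s. So the cover of the codomains of blocks
below p is exactly the normal form of its domain. -/
theorem mem_bd_iff (p : P.complex.Ext (k + 1)) (x : P.complex.Ext k) :
    x ∈ P.complex.bd p ↔ ofExt x ∈ P.δ k (ofExt p) := by
  have hcov : ∀ {y}, x ⋖ y ↔ ofExt x ⋖ ofExt y := fun {y} =>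
    (apply_covBy_apply_iff (extIso P k)).symm
  have hL : ∀ {y}, y ∈ P.complex.leavesCirc p ↔
      ∃ s, NotCod s ∧ s ≤ ofExt p ∧ P.γ k s = ofExt y := by
    intro y
    rw [← ofExt_injective.mem_set_image, ofExt_image_leavesCirc]
    rfl
  rw [(P.hasNormalForms k (ofExt p)).2]
  constructor
  · rintro ⟨⟨y, hy, hxy⟩, hx⟩
    obtain ⟨s, hs, hsp, hsy⟩ := hL.1 hy
    rw [hcov, ← hsy] at hxy
    exact ⟨⟨s, hs, hsp, (P.hasNormalForms k).mem_δ_of_covBy hs hxy⟩,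
      fun t ht htp htx => hx (hL.2 ⟨t, ht, htp, htx⟩)⟩
  · rintro ⟨⟨s, hs, hsp, hxs⟩, hx⟩
    refine ⟨⟨.circ ⟨s, hs⟩, hL.2 ⟨s, hs, hsp, rfl⟩, hcov.2 ((P.hasNormalForms k).covBy hs hxs)⟩, ?_⟩
    intro h
    obtain ⟨t, ht, htp, htx⟩ := hL.1 h
    exact hx t ht htp htx

end Structure

end PositiveOpetopicCardinal

/-! ### The morphism of thicket complexes of an `ι`-epimorphism -/

namespace PositiveOpetopicCardinal

section Morphism

attribute [local instance] upperOrder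

variable {P Q R : PositiveOpetopicCardinal.{u}} (f : P ⟶ Q) {k : ℕ}

/-- `f` maps `y` to `q`, which has the same dimension. -/
def Sends (y : P.S k) (q : Q.S k) : Prop := IotaEpi.toFun f ⟨k, y⟩ = ⟨k, q⟩

/-- `f` maps `α` to a face `q` of dimension one less. -/
def Collapses (α : P.S (k + 1)) (q : Q.S k) : Prop := IotaEpi.toFun f ⟨k + 1, α⟩ = ⟨k, q⟩

variable {f}

theorem Sends.unique {y : P.S k} {q q' : Q.S k} (h : Sends f y q) (h' : Sends f y q') :
    q = q' := by
  have := Eq.trans (Eq.symm h) h'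
  cases this
  rfl

theorem Sends.notMem_ker {y : P.S k} {q : Q.S k} (h : Sends f y q) :
    (⟨k, y⟩ : P.Face) ∉ ker (IotaEpi.toFun f) := by
  intro hk
  change (IotaEpi.toFun f ⟨k, y⟩).1 < k at hk
  rw [show IotaEpi.toFun f ⟨k, y⟩ = ⟨k, q⟩ from h] at hk
  exact lt_irrefl _ hk

theorem Sends.γ {α : P.S (k + 1)} {β : Q.S (k + 1)} (h : Sends f α β) :
    Sends f (P.γ k α) (Q.γ k β) := by
  change IotaEpi.toFun f _ = _
  rw [IotaEpi.map_γ, show IotaEpi.toFun f ⟨k + 1, α⟩ = ⟨k + 1, β⟩ from h, gammaTo_succ]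

theorem Sends.mem_δ {α : P.S (k + 1)} {β : Q.S (k + 1)} (h : Sends f α β) {a : P.S k}
    (ha : a ∈ P.δ k α) {q : Q.S k} (hq : Sends f a q) : q ∈ Q.δ k β := by
  obtain ⟨b, hb, hbq⟩ := (IotaEpi.map_δ f k α β h).mapsTo ⟨⟨a, ha, rfl⟩, hq.notMem_ker⟩
  have := Eq.trans hbq hq
  cases this
  exact hb

theorem Sends.exists_mem_δ {α : P.S (k + 1)} {β : Q.S (k + 1)} (h : Sends f α β) {b : Q.S k}
    (hb : b ∈ Q.δ k β) : ∃ a ∈ P.δ k α, Sends f a b := by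
  obtain ⟨_, ⟨⟨a, ha, rfl⟩, -⟩, hx⟩ := (IotaEpi.map_δ f k α β h).surjOn ⟨b, hb, rfl⟩
  exact ⟨a, ha, hx⟩

theorem Collapses.γ {α : P.S (k + 1)} {q : Q.S k} (h : Collapses f α q) :
    Sends f (P.γ k α) q := by
  change IotaEpi.toFun f _ = _
  rw [IotaEpi.map_γ, show IotaEpi.toFun f ⟨k + 1, α⟩ = ⟨k, q⟩ from h]
  exact gammaTo_of_le _ k ⟨k, q⟩ le_rfl

theorem Collapses.eq {α : P.S (k + 1)} {q : Q.S k} (h : Collapses f α q) {a : P.S k}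
    (ha : a ∈ P.δ k α) {r : Q.S k} (hr : Sends f a r) : r = q := by
  have := (IotaEpi.map_δ_collapse f k α q h).mapsTo ⟨⟨a, ha, rfl⟩, hr.notMem_ker⟩
  have := Eq.trans (Eq.symm hr) this
  cases this
  rfl

theorem Collapses.exists_mem_δ {α : P.S (k + 1)} {q : Q.S k} (h : Collapses f α q) :
    ∃ a ∈ P.δ k α, Sends f a q := by
  obtain ⟨_, ⟨⟨a, ha, rfl⟩, -⟩, hx⟩ := (IotaEpi.map_δ_collapse f k α q h).surjOn rfl
  exact ⟨a, ha, hx⟩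

variable (f) in
theorem sends_or_collapses_or_lt (α : P.S (k + 1)) :
    (∃ β, Sends f α β) ∨ (∃ q, Collapses f α q) ∨ (IotaEpi.toFun f ⟨k + 1, α⟩).1 < k := by
  have h := IotaEpi.dim_le f ⟨k + 1, α⟩
  simp only [Sends, Collapses]
  generalize IotaEpi.toFun f ⟨k + 1, α⟩ = y at *
  obtain ⟨l, y⟩ := y
  obtain rfl | rfl | hl : l = k + 1 ∨ l = k ∨ l < k := by simp only at h; omega
  · exact Or.inl ⟨y, rfl⟩
  · exact Or.inr (Or.inl ⟨y, rfl⟩)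
  · exact Or.inr (Or.inr hl)

theorem Sends.mono_step {α : P.S (k + 1)} {a : P.S k} (ha : a ∈ P.δ k α) {q : Q.S k}
    (h : Sends f a q) : ∃ r, Sends f (P.γ k α) r ∧ q ≤ r := by
  obtain ⟨β, hβ⟩ | ⟨r, hr⟩ | hlt := sends_or_collapses_or_lt f α
  · exact ⟨_, hβ.γ, (lt_γ_of_mem_δ (hβ.mem_δ ha h)).le⟩
  · exact ⟨r, hr.γ, (hr.eq ha h).le⟩
  · exact (h.notMem_ker (IotaEpi.map_δ_ker f k α hlt ⟨a, ha, rfl⟩)).elim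

/-- The faces whose dimension is kept form an up-closed set on which f is monotone: the right-hand
side of the adjunction. -/
theorem Sends.mono {a b : P.S k} (hab : a ≤ b) {q : Q.S k} (h : Sends f a q) :
    ∃ r, Sends f b r ∧ q ≤ r := by
  obtain rfl | hab := hab
  · exact ⟨q, h, le_rfl⟩
  induction hab with
  | single hb => obtain ⟨α, hα, rfl⟩ := hb; exact h.mono_step hα
  | tail _ hb ih =>
    obtain ⟨α, hα, rfl⟩ := hb
    obtain ⟨r, hr, hqr⟩ := ih
    obtain ⟨r', hr', hrr'⟩ := hr.mono_step hα
    exact ⟨r', hr', hqr.trans hrr'⟩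

theorem Sends.of_γ {α : P.S (k + 1)} {q : Q.S k} (h : Sends f (P.γ k α) q) :
    (∃ β, Sends f α β ∧ Q.γ k β = q) ∨ Collapses f α q := by
  obtain ⟨β, hβ⟩ | ⟨r, hr⟩ | hlt := sends_or_collapses_or_lt f α
  · exact Or.inl ⟨β, hβ, hβ.γ.unique h⟩
  · exact Or.inr (hr.γ.unique h ▸ hr)
  · have h' : IotaEpi.toFun f ⟨k, P.γ k α⟩ = ⟨k, q⟩ := h
    rw [IotaEpi.map_γ, gammaTo_of_le _ _ _ hlt.le] at h'
    rw [h'] at hlt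
    exact (lt_irrefl _ hlt).elim

variable (f) in
theorem exists_sends (q : Q.S k) : ∃ y, Sends f y q := by
  obtain ⟨⟨l, y⟩, hy⟩ := IotaEpi.surjective f ⟨k, q⟩
  induction l with
  | zero =>
    have h := IotaEpi.dim_le f ⟨0, y⟩
    rw [hy] at h
    obtain rfl : k = 0 := Nat.le_zero.1 h
    exact ⟨y, hy⟩
  | succ l ih =>
    have h := IotaEpi.dim_le f ⟨l + 1, y⟩
    rw [hy] at h
    obtain rfl | hl : k = l + 1 ∨ k ≤ l := by simp only at h; omega
    · exact ⟨y, hy⟩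
    · refine ih (P.γ l y) ?_
      rw [IotaEpi.map_γ, hy, gammaTo_of_le _ _ _ hl]

variable (f) in
-- A minimal preimage works. If it were γ α, then α would collapse onto q, as q is no codomain, and
-- some face in δ α would be a smaller preimage.
theorem exists_notCod_sends {q : Q.S k} (hq : NotCod q) : ∃ s, NotCod s ∧ Sends f s q := by
  obtain ⟨m, hm⟩ := (Set.toFinite {y | Sends f y q}).exists_minimal (exists_sends f q)
  refine ⟨m, ?_, hm.1⟩
  rintro α rfl
  rcases hm.1.of_γ with ⟨β, -, hβ⟩ | hc
  · exact hq β hβ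
  · obtain ⟨a, ha, haq⟩ := hc.exists_mem_δ
    exact (lt_γ_of_mem_δ ha).not_ge (hm.2 haq (lt_γ_of_mem_δ ha).le)

theorem NotCod.exists_mem_δ {m : Q.S k} (hm : NotCod m) {β : Q.S (k + 1)} (h : m ≤ Q.γ k β) :
    ∃ b ∈ Q.δ k β, m ≤ b := by
  obtain ⟨t, ht, htβ, htγ⟩ := exists_notCod_γ_eq β
  obtain ⟨c, ⟨⟨_, ⟨s, ⟨hs, hsβ⟩, rfl⟩, hcs⟩, hc⟩, hmc⟩ :=
    exists_mem_cover (X := Q.γ k '' {s | NotCod s ∧ s ≤ β}) ⟨t, ⟨ht, htβ⟩, htγ⟩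
      (by rintro ⟨s, -, hs⟩; exact hm s hs) h
  refine ⟨c, ((Q.hasNormalForms k β).2 c).2 ⟨⟨s, hs, hsβ, ?_⟩, ?_⟩, hmc⟩
  · exact (Q.hasNormalForms k).mem_δ_of_covBy hs hcs
  · exact fun t ht htβ htc => hc ⟨t, ⟨ht, htβ⟩, htc⟩

variable (f k) in
/-- Faces in dimension `k` that are not codomains are mapped injectively to such faces. -/
def StarInjective : Prop :=
  (∀ (s t : P.S k) (q : Q.S k), NotCod s → NotCod t → Sends f s q → Sends f t q → s = t) ∧
    ∀ (s : P.S k) (q : Q.S k), NotCod s → Sends f s q → NotCod q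

theorem StarInjective.le (h : StarInjective f k) {y s : P.S k} {q m : Q.S k} (hy : Sends f y q)
    (hm : NotCod m) (hmq : m ≤ q) (hs : NotCod s) (hsm : Sends f s m) : s ≤ y := by
  induction y using (wellFounded_lt (α := P.S k)).induction generalizing q with
  | _ y ih =>
    by_cases hy' : NotCod y
    · obtain rfl := (h.2 y q hy' hy).eq_of_le hmq
      exact (h.1 _ _ _ hs hy' hsm hy).le
    · obtain ⟨α, rfl⟩ : ∃ α, P.γ k α = y := by simpa [NotCod] using hy'
      rcases hy.of_γ with ⟨β, hβ, rfl⟩ | hc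
      · obtain ⟨b, hb, hmb⟩ := hm.exists_mem_δ hmq
        obtain ⟨a, ha, hab⟩ := hβ.exists_mem_δ hb
        exact (ih a (lt_γ_of_mem_δ ha) hab hmb).trans (lt_γ_of_mem_δ ha).le
      · obtain ⟨a, ha, haq⟩ := hc.exists_mem_δ
        exact (ih a (lt_γ_of_mem_δ ha) haq hmq).trans (lt_γ_of_mem_δ ha).le

theorem StarInjective.comparable (h : StarInjective f k) {y z : P.S k} {q : Q.S k}
    (hy : Sends f y q) (hz : Sends f z q) : y ≤ z ∨ z ≤ y := by
  obtain ⟨m, hm, hmq⟩ := exists_notCod_le q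
  obtain ⟨s, hs, hsm⟩ := exists_notCod_sends f hm
  exact P.isForest_S k s y z (h.le hy hm hmq hs hsm) (h.le hz hm hmq hs hsm)

theorem Sends.γ_lt {s t : P.S (k + 1)} (ht : NotCod t) (hst : P.γ k s < P.γ k t)
    {q r : Q.S (k + 1)} (hs : Sends f s q) (htr : Sends f t r) : Q.γ k q < Q.γ k r := by
  obtain ⟨c, hc, hsc⟩ := (P.hasNormalForms k).exists_of_lt_γ ht hst
  obtain ⟨u, hu, hqu⟩ := hs.γ.mono hsc
  exact hqu.trans_lt (lt_γ_of_mem_δ (htr.mem_δ hc hu))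

/-- If the images of two blocks s, t have equal codomains, then γ s and γ t are comparable by the
case of dimension k. A strict inequality would persist after applying f, so γ s = γ t and s = t. -/
theorem StarInjective.succ (h : StarInjective f k) : StarInjective f (k + 1) := by
  have key : ∀ (s t : P.S (k + 1)) (q r : Q.S (k + 1)), NotCod s → NotCod t → Sends f s q →
      Sends f t r → Q.γ k q = Q.γ k r → s = t := by
    intro s t q r hs ht hsq htr hqr
    rcases h.comparable hsq.γ (hqr ▸ htr.γ) with h1 | h1
    · rcases h1.eq_or_lt with h1 | h1
      · exact hs.γ_injective ht h1
      · exact ((hsq.γ_lt ht h1 htr).ne hqr).elim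
    · rcases h1.eq_or_lt with h1 | h1
      · exact (ht.γ_injective hs h1).symm
      · exact ((htr.γ_lt hs h1 hsq).ne hqr.symm).elim
  refine ⟨fun s t q hs ht hsq htq => key s t q q hs ht hsq htq rfl, fun s q hs hsq => ?_⟩
  obtain ⟨m, hm, -, hmγ⟩ := exists_notCod_γ_eq q
  obtain ⟨t, ht, htm⟩ := exists_notCod_sends f hm
  obtain rfl := key s t q m hs ht hsq htm hmγ.symm
  rwa [hsq.unique htm]

variable (f k) in
theorem starInjective : StarInjective f k := by
  induction k with
  | zero =>
    have key : ∀ s t : P.S 0, NotCod s → NotCod t → s = t := fun s t hs ht =>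
      congrArg Subtype.val (starFace_zero_eq (P := P) ⟨s, hs⟩ ⟨t, ht⟩)
    refine ⟨fun s t q hs ht _ _ => key s t hs ht, fun s q hs hsq => ?_⟩
    obtain ⟨m, hm, -⟩ := exists_notCod_le q
    obtain ⟨t, ht, htm⟩ := exists_notCod_sends f hm
    obtain rfl := key s t hs ht
    rwa [hsq.unique htm]
  | succ k ih => exact ih.succ

/-- The half of the adjunction for circles; `StarInjective.le` is the half for dots. Both descend
from y into the domain of a face with codomain y. -/
theorem γ_le_of_sends {y : P.S k} {q : Q.S k} (hy : Sends f y q) {t : Q.S (k + 1)} (ht : NotCod t)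
    (htq : Q.γ k t ≤ q) {s : P.S (k + 1)} (hs : NotCod s) (hst : Sends f s t) :
    P.γ k s ≤ y := by
  induction y using (wellFounded_lt (α := P.S k)).induction generalizing q with
  | _ y ih =>
    by_cases hy' : NotCod y
    · exact ((starInjective f k).2 y q hy' hy t
        (((starInjective f k).2 y q hy' hy).eq_of_le htq)).elim
    · obtain ⟨α', hα'⟩ : ∃ α, P.γ k α = y := by simpa [NotCod] using hy'
      obtain ⟨α, hα, -, hαγ⟩ := exists_notCod_γ_eq α'
      rw [hα'] at hαγ
      subst hαγ
      rcases hy.of_γ with ⟨β, hβ, rfl⟩ | hc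
      · have hβ' := (starInjective f (k + 1)).2 α β hα hβ
        rcases htq.eq_or_lt with h | h
        · obtain rfl := ht.γ_injective hβ' h
          rw [(starInjective f (k + 1)).1 s α t hs hα hst hβ]
        · obtain ⟨b, hb, htb⟩ := (Q.hasNormalForms k).exists_of_lt_γ hβ' h
          obtain ⟨a, ha, hab⟩ := hβ.exists_mem_δ hb
          exact (ih a (lt_γ_of_mem_δ ha) hab htb).trans (lt_γ_of_mem_δ ha).le
      · obtain ⟨a, ha, haq⟩ := hc.exists_mem_δ
        exact (ih a (lt_γ_of_mem_δ ha) haq htq).trans (lt_γ_of_mem_δ ha).le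

variable (f) in
/-- The section of `f` on faces that are not codomains. -/
noncomputable def lift (i : ℕ) (q : Q.StarFace i) : P.StarFace i :=
  ⟨(exists_notCod_sends f q.notCod).choose, (exists_notCod_sends f q.notCod).choose_spec.1⟩

variable (f) in
theorem sends_lift (i : ℕ) (q : Q.StarFace i) : Sends f (lift f i q).1 q.1 :=
  (exists_notCod_sends f q.notCod).choose_spec.2

theorem isStarMap_lift : IsStarMap f (lift f) := by
  intro i q p
  constructor
  · rintro rfl
    exact sends_lift f i q
  · exact fun h => Subtype.ext
      ((starInjective f i).1 _ _ _ (lift f i q).notCod p.notCod (sends_lift f i q) h)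

variable (f) in
/-- The map on extensions induced by the section of `f`. -/
noncomputable def liftExt (x : Q.complex.Ext k) : P.complex.Ext k :=
  ThicketComplex.extMap (S := Q.complex) (T := P.complex) (lift f) k x

theorem sends_liftExt (x : Q.complex.Ext k) : Sends f (ofExt (liftExt f x)) (ofExt x) := by
  cases x with
  | circ s => exact (sends_lift f (k + 1) s).γ
  | dot s => exact sends_lift f k s

/-- The Galois connection: `liftExt f` is left adjoint to f, read as a partial map on k-dimensional
faces. Order embedding and behaviour on suprema are formal consequences. -/
theorem liftExt_le_iff {x : Q.complex.Ext k} {y : P.S k} :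
    ofExt (liftExt f x) ≤ y ↔ ∃ q, Sends f y q ∧ ofExt x ≤ q := by
  constructor
  · exact fun h => (sends_liftExt x).mono h
  · rintro ⟨q, hy, hxq⟩
    cases x with
    | circ s =>
      exact γ_le_of_sends hy (StarFace.notCod s) hxq (StarFace.notCod (lift f (k + 1) s))
        (sends_lift f (k + 1) s)
    | dot s =>
      exact (starInjective f k).le hy (StarFace.notCod s) hxq (StarFace.notCod (lift f k s))
        (sends_lift f k s)

theorem liftExt_le_ext_iff {x : Q.complex.Ext k} {y : P.complex.Ext k} :
    liftExt f x ≤ y ↔ ∃ z, Sends f (ofExt y) (ofExt z) ∧ x ≤ z := by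
  rw [← ofExt_le, liftExt_le_iff]
  constructor
  · rintro ⟨q, hq, hxq⟩
    obtain ⟨z, rfl⟩ := ofExt_surjective q
    exact ⟨z, hq, ofExt_le.1 hxq⟩
  · rintro ⟨z, hz, hxz⟩
    exact ⟨_, hz, ofExt_le.2 hxz⟩

theorem liftExt_le_liftExt {x y : Q.complex.Ext k} : liftExt f x ≤ liftExt f y ↔ x ≤ y := by
  rw [liftExt_le_ext_iff]
  constructor
  · rintro ⟨z, hz, hxz⟩
    rwa [ofExt_injective ((sends_liftExt y).unique hz)]
  · exact fun h => ⟨y, sends_liftExt y, h⟩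

theorem isLUB_liftExt {x y z : Q.complex.Ext k} (h : IsLUB {x, y} z) :
    IsLUB {liftExt f x, liftExt f y} (liftExt f z) := by
  refine ⟨?_, fun w hw => ?_⟩
  · rintro _ (rfl | rfl)
    · exact liftExt_le_liftExt.2 (h.1 (by simp))
    · exact liftExt_le_liftExt.2 (h.1 (by simp))
  · obtain ⟨u, hu, hxu⟩ := liftExt_le_ext_iff.1 (hw (by simp) : liftExt f x ≤ w)
    obtain ⟨v, hv, hyv⟩ := liftExt_le_ext_iff.1 (hw (by simp) : liftExt f y ≤ w)
    obtain rfl := ofExt_injective (hu.unique hv)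
    refine liftExt_le_ext_iff.2 ⟨u, hu, h.2 ?_⟩
    rintro _ (rfl | rfl) <;> assumption

theorem exists_isLUB_of_liftExt {x y : Q.complex.Ext k}
    (h : ∃ w, IsLUB {liftExt f x, liftExt f y} w) : ∃ z, IsLUB {x, y} z := by
  obtain ⟨w, hw, -⟩ := h
  obtain ⟨u, hu, hxu⟩ := liftExt_le_ext_iff.1 (hw (by simp) : liftExt f x ≤ w)
  obtain ⟨v, hv, hyv⟩ := liftExt_le_ext_iff.1 (hw (by simp) : liftExt f y ≤ w)
  obtain rfl := ofExt_injective (hu.unique hv)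
  exact (ThicketComplex.isForest_ext Q.complex k).exists_isLUB hxu hyv

theorem lift_le_iff (i : ℕ) (x y : Q.StarFace i) : lift f i x ≤ lift f i y ↔ x ≤ y := by
  cases i with
  | zero => exact iff_of_true (starFace_zero_eq _ _).le (starFace_zero_eq _ _).le
  | succ k => exact liftExt_le_liftExt (f := f) (x := .circ x) (y := .circ y)

variable (f) in
/-- The morphism of thicket complexes `f^*`. -/
noncomputable def liftHom : Q.complex ⟶ P.complex :=
  ThicketComplex.Hom.mk (S := Q.complex) (T := P.complex) (lift f) lift_le_iff
    (fun _ _ _ => liftExt_le_liftExt) (fun _ _ _ _ => isLUB_liftExt)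
    (fun _ _ _ => exists_isLUB_of_liftExt)

theorem liftHom_eq {g : Q.complex ⟶ P.complex}
    (hg : ∀ i (q : Q.StarFace i), Sends f (ThicketComplex.Hom.toFun g i q : P.StarFace i).1 q.1) :
    liftHom f = g := by
  refine ThicketComplex.Hom.ext ?_
  funext i q
  exact (isStarMap_lift i q _).2 (hg i q)

theorem liftHom_id (P : PositiveOpetopicCardinal.{u}) : liftHom (𝟙 P) = 𝟙 P.complex :=
  liftHom_eq fun _ _ => rfl

theorem liftHom_comp (f : P ⟶ Q) (g : Q ⟶ R) : liftHom (f ≫ g) = liftHom g ≫ liftHom f := by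
  refine liftHom_eq fun i q => ?_
  have h1 : Sends g (lift g i q).1 q.1 := sends_lift g i q
  have h2 : Sends f (lift f i (lift g i q)).1 (lift g i q).1 := sends_lift f i _
  exact (congrArg (IotaEpi.toFun g) h2).trans h1

end Morphism

end PositiveOpetopicCardinal

/-! ### The two natural isomorphisms -/

namespace PositiveOpetopicCardinal

/-- A family of bijections that is compatible with the codomain and domain operations. -/
def homOfEquiv {P Q : PositiveOpetopicCardinal.{u}} (e : ∀ k, P.S k ≃ Q.S k)
    (hγ : ∀ k (a : P.S (k + 1)), e k (P.γ k a) = Q.γ k (e (k + 1) a))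
    (hδ : ∀ k (a : P.S (k + 1)) (x : P.S k), x ∈ P.δ k a ↔ e k x ∈ Q.δ k (e (k + 1) a)) :
    P ⟶ Q :=
  IotaEpi.mk (fun x => ⟨x.1, e x.1 x.2⟩) (fun _ => le_rfl)
    (fun k a => by
      change (⟨k, e k (P.γ k a)⟩ : Q.Face) = Q.gammaTo k ⟨k + 1, e (k + 1) a⟩
      rw [gammaTo_succ, hγ])
    (fun k a b h => by
      obtain rfl : e (k + 1) a = b := by simpa using h
      refine ⟨?_, ?_, ?_⟩
      · rintro _ ⟨⟨x, hx, rfl⟩, -⟩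
        exact ⟨_, (hδ k a x).1 hx, rfl⟩
      · rintro _ ⟨⟨x, hx, rfl⟩, -⟩ _ ⟨⟨y, hy, rfl⟩, -⟩ h
        simpa using h
      · rintro _ ⟨y, hy, rfl⟩
        obtain ⟨x, rfl⟩ := (e k).surjective y
        exact ⟨⟨k, x⟩, ⟨⟨x, (hδ k a x).2 hy, rfl⟩, lt_irrefl k⟩, rfl⟩)
    (fun k a b h => by simpa using congrArg Sigma.fst h)
    (fun k a h => by simp at h)
    (by
      rintro ⟨k, y⟩
      obtain ⟨x, rfl⟩ := (e k).surjective y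
      exact ⟨⟨k, x⟩, rfl⟩)

theorem hom_ext {P Q : PositiveOpetopicCardinal.{u}} {f g : P ⟶ Q}
    (h : ∀ k (x : P.S k), IotaEpi.toFun f ⟨k, x⟩ = IotaEpi.toFun g ⟨k, x⟩) : f = g :=
  IotaEpi.ext (funext fun x => h x.1 x.2)

/-- An isomorphism from a family of bijections. -/
def isoOfEquiv {P Q : PositiveOpetopicCardinal.{u}} (e : ∀ k, P.S k ≃ Q.S k)
    (hγ : ∀ k (a : P.S (k + 1)), e k (P.γ k a) = Q.γ k (e (k + 1) a))
    (hδ : ∀ k (a : P.S (k + 1)) (x : P.S k), x ∈ P.δ k a ↔ e k x ∈ Q.δ k (e (k + 1) a)) :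
    P ≅ Q where
  hom := homOfEquiv e hγ hδ
  inv := homOfEquiv (fun k => (e k).symm)
    (fun k a => by rw [Equiv.symm_apply_eq, hγ, Equiv.apply_symm_apply])
    (fun k a x => by rw [hδ, Equiv.apply_symm_apply, Equiv.apply_symm_apply])
  hom_inv_id := hom_ext fun k x => congrArg (Sigma.mk k) ((e k).symm_apply_apply x)
  inv_hom_id := hom_ext fun k x => congrArg (Sigma.mk k) ((e k).apply_symm_apply x)

end PositiveOpetopicCardinal

namespace ThicketComplex

/-- The positive opetopic cardinal `T^*`. -/
noncomputable def cardinal (T : ThicketComplex.{u}) : PositiveOpetopicCardinal.{u} :=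
  ⟨T.star, star_isPositiveOpetopicCardinal T⟩

theorem pullHom_id (T : ThicketComplex.{u}) : pullHom (𝟙 T) = 𝟙 T.cardinal :=
  PositiveOpetopicCardinal.hom_ext fun _ t => pull_id t

theorem pullHom_comp {S T U : ThicketComplex.{u}} (f : S ⟶ T) (g : T ⟶ U) :
    pullHom (f ≫ g) = (pullHom g ≫ pullHom f : U.cardinal ⟶ S.cardinal) :=
  PositiveOpetopicCardinal.hom_ext fun _ t => pull_comp f g t

theorem hom_ext {S T : ThicketComplex.{u}} {f g : S ⟶ T}
    (h : ∀ i x, Hom.toFun f i x = Hom.toFun g i x) : f = g :=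
  Hom.ext (funext fun i => funext fun x => h i x)

/-- A family of order isomorphisms that is compatible with the constellations. -/
def homOfOrderIso {S T : ThicketComplex.{u}} (e : ∀ i, S.T i ≃o T.T i)
    (hτ : ∀ i (t : S.T (i + 1)) (s : S.T i), s ∈ S.τ i t ↔ e i s ∈ T.τ i (e (i + 1) t)) :
    S ⟶ T :=
  have hle : ∀ i (x y : S.Ext i),
      extMap (fun i => e i) i x ≤ extMap (fun i => e i) i y ↔ x ≤ y := by
    intro i x y
    cases x <;> cases y
    · exact (e (i + 1)).le_iff_le
    · exact iff_of_false not_circ_le_dot not_circ_le_dot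
    · exact (hτ i _ _).symm
    · exact (e i).apply_eq_iff_eq
  have hsurj : ∀ i (w : T.Ext i), ∃ z, extMap (fun i => e i) i z = w := by
    rintro i (t | s)
    · exact ⟨.circ ((e (i + 1)).symm t), congrArg _ ((e (i + 1)).apply_symm_apply t)⟩
    · exact ⟨.dot ((e i).symm s), congrArg _ ((e i).apply_symm_apply s)⟩
  have hsup : ∀ i (x y z : S.Ext i), IsLUB {extMap (fun i => e i) i x, extMap (fun i => e i) i y}
      (extMap (fun i => e i) i z) ↔ IsLUB {x, y} z := by
    intro i x y z
    simp only [isLUB_iff_le_iff, mem_upperBounds, Set.mem_insert_iff, Set.mem_singleton_iff,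
      forall_eq_or_imp, forall_eq]
    rw [(show Function.Surjective (extMap (S := S) (T := T) (fun i => e i) i) from hsurj i).forall]
    simp only [hle]
  Hom.mk (fun i => e i) (fun i _ _ => (e i).le_iff_le) hle (fun i x y z => (hsup i x y z).2)
    (fun i x y ⟨w, hw⟩ => by
      obtain ⟨z, rfl⟩ := hsurj i w
      exact ⟨z, (hsup i x y z).1 hw⟩)

/-- An isomorphism from a family of order isomorphisms. -/
def isoOfOrderIso {S T : ThicketComplex.{u}} (e : ∀ i, S.T i ≃o T.T i)
    (hτ : ∀ i (t : S.T (i + 1)) (s : S.T i), s ∈ S.τ i t ↔ e i s ∈ T.τ i (e (i + 1) t)) :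
    S ≅ T where
  hom := homOfOrderIso e hτ
  inv := homOfOrderIso (fun i => (e i).symm) fun i t s => by
    rw [hτ, OrderIso.apply_symm_apply, OrderIso.apply_symm_apply]
  hom_inv_id := hom_ext fun i x => (e i).symm_apply_apply x
  inv_hom_id := hom_ext fun i x => (e i).apply_symm_apply x

/-- The dots are the faces of `T^*` that are not codomains. -/
def toStarFace (T : ThicketComplex.{u}) (i : ℕ) (s : T.T i) : T.cardinal.StarFace i :=
  ⟨(.dot s : T.Ext i), fun q => cod_ne_dot q s⟩

theorem toStarFace_bijective (T : ThicketComplex.{u}) (i : ℕ) :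
    Function.Bijective (T.toStarFace i) := by
  constructor
  · intro s t h
    have : (.dot s : T.Ext i) = .dot t := congrArg Subtype.val h
    cases this
    rfl
  · rintro ⟨(t | s), h⟩
    · exact (h (.dot t : T.Ext (i + 1)) (cod_dot t)).elim
    · exact ⟨s, rfl⟩

theorem toStarFace_le_iff (T : ThicketComplex.{u}) (i : ℕ) (s t : T.T i) :
    T.toStarFace i s ≤ T.toStarFace i t ↔ s ≤ t := by
  cases i with
  | zero =>
    obtain ⟨z, hz⟩ := T.isThicketComplex.singleton_zero
    rw [hz s, hz t]
    exact iff_of_true le_rfl le_rfl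
  | succ k =>
    rw [PositiveOpetopicCardinal.StarFace.le_iff]
    change T.cod (.dot s) = T.cod (.dot t) ∨ T.star.upperLt k (T.cod (.dot s)) (T.cod (.dot t)) ↔ _
    rw [star_upperLt, ← le_iff_eq_or_lt, cod_dot, cod_dot, circ_le_circ]

/-- The isomorphism from `T` to `T^**`. -/
noncomputable def unitIso (T : ThicketComplex.{u}) : T ≅ T.cardinal.complex :=
  isoOfOrderIso (T := T.cardinal.complex)
    (fun i => { Equiv.ofBijective _ (T.toStarFace_bijective i) with
      map_rel_iff' := T.toStarFace_le_iff i _ _ })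
    (fun i t s => by
      change _ ↔ T.star.upperLt i (.dot s) (T.cod (.dot t))
      rw [star_upperLt, cod_dot, dot_lt_circ])

/-- By uniqueness of preimages among faces that are not codomains, it suffices that `pull f` sends
the image of a dot back to that dot. -/
theorem unitIso_naturality {S T : ThicketComplex.{u}} (f : S ⟶ T) :
    f ≫ T.unitIso.hom =
      S.unitIso.hom ≫ PositiveOpetopicCardinal.liftHom (P := T.cardinal) (pullHom f) := by
  refine hom_ext fun i s => Eq.symm ?_
  refine (PositiveOpetopicCardinal.isStarMap_lift (P := T.cardinal) (Q := S.cardinal)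
    (f := pullHom f) i (S.toStarFace i s) (T.toStarFace i (Hom.toFun f i s))).2 ?_
  change pull f i (ext f (.dot s)) = _
  exact pull_of_isGreatest ⟨mem_under.2 le_rfl, fun _ h => (ext_le_ext f).1 h⟩

end ThicketComplex

namespace PositiveOpetopicCardinal

/-- The isomorphism from `P^**` to `P`. -/
noncomputable def counitIso (P : PositiveOpetopicCardinal.{u}) : P.complex.cardinal ≅ P :=
  isoOfEquiv (P := P.complex.cardinal)
    (fun _ => Equiv.ofBijective ofExt ⟨ofExt_injective, ofExt_surjective⟩)
    (fun _ a => ofExt_cod a) (fun _ a x => mem_bd_iff a x)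

/-- By the adjunction, the greatest element lifted below t is the value of f at t when f keeps the
dimension. Otherwise nothing is lifted below t, and both sides pass to the codomain. -/
theorem toFun_ofExt {P Q : PositiveOpetopicCardinal.{u}} (f : P ⟶ Q) {k : ℕ}
    (t : P.complex.Ext k) :
    IotaEpi.toFun Q.counitIso.hom (ThicketComplex.pull (liftHom f) k t) =
      IotaEpi.toFun f ⟨k, ofExt t⟩ := by
  have main : ∀ {k : ℕ} (t : P.complex.Ext k), (ThicketComplex.under (liftHom f) t).Nonempty →
      IotaEpi.toFun Q.counitIso.hom (ThicketComplex.pull (liftHom f) k t) =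
        IotaEpi.toFun f ⟨k, ofExt t⟩ := by
    rintro k t ⟨x, hx⟩
    obtain ⟨z, hz, -⟩ := liftExt_le_ext_iff.1 (show liftExt f x ≤ t from hx)
    have hg : IsGreatest (ThicketComplex.under (liftHom f) t) z := by
      refine ⟨liftExt_le_ext_iff.2 ⟨z, hz, le_rfl⟩, fun y hy => ?_⟩
      obtain ⟨w, hw, hyw⟩ := liftExt_le_ext_iff.1 (show liftExt f y ≤ t from hy)
      rwa [ofExt_injective (hz.unique hw)]
    rw [ThicketComplex.pull_of_isGreatest hg]
    exact hz.symm
  induction k with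
  | zero => exact main t (ThicketComplex.under_zero_nonempty t)
  | succ k ih =>
    by_cases h : (ThicketComplex.under (liftHom f) t).Nonempty
    · exact main t h
    rw [ThicketComplex.pull_of_empty h, ih, ofExt_cod, IotaEpi.map_γ]
    refine gammaTo_of_le _ _ _ ?_
    rcases sends_or_collapses_or_lt f (ofExt t) with ⟨β, hβ⟩ | ⟨q, hq⟩ | hlt
    · obtain ⟨z, rfl⟩ := ofExt_surjective β
      exact (h ⟨z, liftExt_le_ext_iff.2 ⟨z, hβ, le_rfl⟩⟩).elim
    · rw [show IotaEpi.toFun f ⟨k + 1, ofExt t⟩ = ⟨k, q⟩ from hq]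
    · exact hlt.le

theorem counitIso_naturality {P Q : PositiveOpetopicCardinal.{u}} (f : P ⟶ Q) :
    ThicketComplex.pullHom (liftHom f) ≫ Q.counitIso.hom = P.counitIso.hom ≫ f :=
  hom_ext fun _ t => toFun_ofExt f t

end PositiveOpetopicCardinal

/-! ### The equivalence -/

/-- The functor from positive opetopic cardinals to thicket complexes. -/
noncomputable def complexFunctor : PositiveOpetopicCardinal.{u} ⥤ ThicketComplex.{u}ᵒᵖ :=
  contraFunctor PositiveOpetopicCardinal.complex PositiveOpetopicCardinal.liftHom
    PositiveOpetopicCardinal.liftHom_id PositiveOpetopicCardinal.liftHom_comp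

/-- The functor from thicket complexes to positive opetopic cardinals. -/
noncomputable def cardinalFunctor : ThicketComplex.{u}ᵒᵖ ⥤ PositiveOpetopicCardinal.{u} :=
  (contraFunctor ThicketComplex.cardinal ThicketComplex.pullHom
    ThicketComplex.pullHom_id ThicketComplex.pullHom_comp).leftOp

/-- The duality of positive opetopic cardinals and thicket complexes. -/
noncomputable def duality : PositiveOpetopicCardinal.{u} ≌ ThicketComplex.{u}ᵒᵖ :=
  -- `Equivalence.mk` corrects the unit, so no triangle identity has to be checked.
  CategoryTheory.Equivalence.mk complexFunctor cardinalFunctor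
    (NatIso.ofComponents (F := complexFunctor ⋙ cardinalFunctor) (G := 𝟭 _)
      (fun P => P.counitIso) fun f => PositiveOpetopicCardinal.counitIso_naturality f).symm
    (NatIso.ofComponents (F := cardinalFunctor ⋙ complexFunctor) (G := 𝟭 _)
      (fun T => T.unop.unitIso.op) fun f =>
        congrArg Quiver.Hom.op (ThicketComplex.unitIso_naturality f.unop).symm)

end OpeDuality

theorem mainTheorem2 :
    ∃ E : OpeDuality.PositiveOpetopicCardinal.{u} ≌ OpeDuality.ThicketComplex.{u}ᵒᵖ,
      OpeDuality.IsStarOfCardinals E.functor ∧ OpeDuality.IsStarOfComplexes E.inverse :=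
  ⟨OpeDuality.duality,
    ⟨OpeDuality.PositiveOpetopicCardinal.star_isThicketComplex,
      OpeDuality.PositiveOpetopicCardinal.liftHom,
      OpeDuality.PositiveOpetopicCardinal.liftHom_id,
      OpeDuality.PositiveOpetopicCardinal.liftHom_comp,
      fun _ => OpeDuality.PositiveOpetopicCardinal.isStarMap_lift, rfl⟩,
    ⟨OpeDuality.ThicketComplex.star_isPositiveOpetopicCardinal,
      OpeDuality.ThicketComplex.pullHom,
      OpeDuality.ThicketComplex.pullHom_id,
      OpeDuality.ThicketComplex.pullHom_comp,
      fun _ => OpeDuality.ThicketComplex.isStarMap_pullFace, rfl⟩⟩
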